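/- Let $Av(4123,1342)$ be the class of all permutations that contain neither the pattern $4123$ nor the pattern $1342$, let $a_n$ be the number of its members of length $n$, and let $\mathcal P_3(z)=\sum_{n\ge 0}a_nz^n$. Then, as formal power series, $$\mathcal P_3(z)=1+\frac{z(1-z)(1-2z)\bigl(1-7z+17z^2-16z^3+4z^4+(1-3z+3z^2)\sqrt{1-4z}\bigr)}{D(z)},$$ where $\sqrt{1-4z}$ has constant term $1$ and $$D(z)=2-22z+96z^2-220z^3+282z^4-196z^5+64z^6-8z^7$$ is of degree $7$. The polynomial $D$ has exactly one complex root $z_0$ in the disc $|z|\le\frac14$, whose radius is given by the square-root singularity at $\frac14$; this root is real, with $0<z_0<\frac14$ and $|z_0-0.239788|<5\cdot 10^{-7}$. The growth rate of $Av(4123,1342)$, i.e. $\lim_{n\to\infty}a_n^{1/n}$, exists and equals $$\frac1{z_0},\qquad \left|\frac1{z_0}-4.17035\right|<10^{-5}.$$ -/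

import Mathlib

open Filter Topology

/-- The permutation `σ` of length `n` contains the pattern `p` of length `k`: at some `k` positions
`f 0 < f 1 < ⋯` its values are in the same relative order as `p 0, p 1, …`. -/
def PermContains {k n : ℕ} (σ : Equiv.Perm (Fin n)) (p : Equiv.Perm (Fin k)) : Prop :=
  ∃ f : Fin k ↪o Fin n, ∀ i j : Fin k, σ (f i) < σ (f j) ↔ p i < p j

/-- The pattern `4123`; one-line notation with values shifted to start at `0`. The second vector is
the inverse permutation. -/
def pattern4123 : Equiv.Perm (Fin 4) :=
  ⟨![3, 0, 1, 2], ![1, 2, 3, 0], by decide, by decide⟩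

/-- The pattern `1342`; one-line notation with values shifted to start at `0`. The second vector is
the inverse permutation. -/
def pattern1342 : Equiv.Perm (Fin 4) :=
  ⟨![0, 2, 3, 1], ![0, 3, 1, 2], by decide, by decide⟩

/-- The permutations of length `n` in the class `Av(4123, 1342)`. -/
def avSet (n : ℕ) : Set (Equiv.Perm (Fin n)) :=
  {σ | ¬ PermContains σ pattern4123 ∧ ¬ PermContains σ pattern1342}

/-- The number of permutations of length `n` in `Av(4123, 1342)`. -/
noncomputable def avCount (n : ℕ) : ℕ := (avSet n).ncard

/-- The generating function of the class, by length (the empty permutation included). -/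
noncomputable def genFunP3 : PowerSeries ℤ := PowerSeries.mk fun n => (avCount n : ℤ)

/-- A class with `u n` members of length `n` has (proper) growth rate `r`: the `n`-th roots of the
counts converge to `r`. -/
def HasGrowthRate (u : ℕ → ℕ) (r : ℝ) : Prop :=
  Tendsto (fun n : ℕ => (u n : ℝ) ^ (1 / (n : ℝ))) atTop (𝓝 r)

/-- The denominator of the closed form of the generating function. -/
noncomputable def denomP3 : Polynomial ℤ :=
  2 - 22 * Polynomial.X + 96 * Polynomial.X ^ 2 - 220 * Polynomial.X ^ 3
    + 282 * Polynomial.X ^ 4 - 196 * Polynomial.X ^ 5 + 64 * Polynomial.X ^ 6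
    - 8 * Polynomial.X ^ 7

/-- The numerator of (closed form minus `1`), where `s` stands for `√(1 - 4 X)`. -/
noncomputable def numerP3 (s : PowerSeries ℤ) : PowerSeries ℤ :=
  PowerSeries.X * (1 - PowerSeries.X) * (1 - 2 * PowerSeries.X) *
    (1 - 7 * PowerSeries.X + 17 * PowerSeries.X ^ 2 - 16 * PowerSeries.X ^ 3
      + 4 * PowerSeries.X ^ 4 + (1 - 3 * PowerSeries.X + 3 * PowerSeries.X ^ 2) * s)

/-!
Reading the inverse permutation as a list of reversed positions (`code`) turns the insertion of a
new first entry into the insertion of a new maximum into a list, with the other entries unchanged.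
A site of the list is active, i.e. the insertion creates neither `4123` nor `1342`, when the part
to its left avoids `321` and the part to its right avoids `132`. The active sites are therefore
the cuts of a contiguous factor, the *window* (`Window.isActive_iff`), and the window avoids both
`321` and `132`. Together with a bounded amount of information on the entries to its right, it has
one of four shapes with one to three increasing runs, and the lengths of these runs determine the
shapes that follow an insertion (`Window.insert`, `HasShape.growCount_eq`). So `avCount` counts
the paths of an explicit infinite generating tree (`avCount_eq_paths`).

The generating functions of the shapes satisfy a linear recursion with a unique solution
(`Shape.eq_mul_genFun`). Up to a common factor the solution is a combination of powers of the
Catalan series `C` and of `1 / (1 - X)` with exponents given by the run lengths (`closedForm_eq`);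
this is the outcome of the kernel method, whose kernel is `C = 1 + X C²`. At the root of the tree,
with `√(1 - 4 X) = 1 - 2 X C`, it is the closed form (`denomP3_mul_genFunP3_sub_one`).

For the growth rate, multiplying the denominator by a suitable polynomial (`multiplierFun`) makes
it so close to a linear polynomial that its difference quotients cannot vanish on the polydisc of
radius `1 / 4`, in any seminormed ring (`le_prodQuotient_mul`). In `ℂ` this gives the uniqueness
of the root `z`. For the `ℓ¹` norms of power series it shows that the generating function
times `X - z` converges absolutely at `z`; its value there is nonzero because the numerator does not
vanish. As the partial sums telescope, `aₙ zⁿ⁺¹` has a positive limit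
(`exists_tendsto_avCount_mul_pow`), which yields the growth rate `1 / z`.
-/

/-! ### Inserting a first entry -/

/-- The permutation of length `n + 1` with first value `v` whose remaining entries are in the same
relative order as `τ`. -/
def consPerm {n : ℕ} (v : Fin (n + 1)) (τ : Equiv.Perm (Fin n)) : Equiv.Perm (Fin (n + 1)) where
  toFun := Fin.cons v fun i => v.succAbove (τ i)
  invFun := v.insertNth 0 fun j => (τ.symm j).succ
  left_inv i := by
    refine Fin.cases ?_ (fun i => ?_) i <;> simp
  right_inv i := by
    rcases Fin.eq_self_or_eq_succAbove v i with rfl | ⟨j, rfl⟩ <;> simp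

@[simp] lemma consPerm_zero {n : ℕ} (v : Fin (n + 1)) (τ : Equiv.Perm (Fin n)) :
    consPerm v τ 0 = v := rfl

@[simp] lemma consPerm_succ {n : ℕ} (v : Fin (n + 1)) (τ : Equiv.Perm (Fin n)) (i : Fin n) :
    consPerm v τ i.succ = v.succAbove (τ i) := rfl

lemma consPerm_bijective (n : ℕ) :
    Function.Bijective fun x : Fin (n + 1) × Equiv.Perm (Fin n) => consPerm x.1 x.2 := by
  rw [Fintype.bijective_iff_injective_and_card]
  constructor
  · rintro ⟨v, τ⟩ ⟨w, ρ⟩ h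
    obtain rfl : v = w := by simpa using DFunLike.congr_fun h 0
    suffices τ = ρ by rw [this]
    ext i
    have := DFunLike.congr_fun h i.succ
    simp only [consPerm_succ] at this
    rw [Fin.succAbove_right_injective this]
  · simp [Fintype.card_perm, Nat.factorial_succ]

/-- An occurrence of `p` in `consPerm v τ` either lies in `τ` or uses the first entry. -/
lemma permContains_consPerm {k n : ℕ} (p : Equiv.Perm (Fin (k + 1))) (v : Fin (n + 1))
    (τ : Equiv.Perm (Fin n)) :
    PermContains (consPerm v τ) p ↔ PermContains τ p ∨
      ∃ g : Fin k ↪o Fin n, (∀ i j, τ (g i) < τ (g j) ↔ p i.succ < p j.succ) ∧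
        ∀ i, v.succAbove (τ (g i)) < v ↔ p i.succ < p 0 := by
  constructor
  · rintro ⟨f, hf⟩
    have hpos : ∀ i : Fin k, ∃ a, f i.succ = Fin.succ a := fun i =>
      Fin.exists_succ_eq.2 (fun h => absurd (f.strictMono (Fin.succ_pos i)) (by simp [h])) |>.imp
        fun _ h => h.symm
    choose g hg using hpos
    have gmono : StrictMono g := fun i j hij => by
      rw [← Fin.succ_lt_succ_iff, ← hg, ← hg]
      exact f.strictMono (Fin.succ_lt_succ_iff.2 hij)
    by_cases h0 : f 0 = 0
    · right
      refine ⟨OrderEmbedding.ofStrictMono g gmono, fun i j => ?_, fun i => ?_⟩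
      · simpa [hg] using hf i.succ j.succ
      · simpa [hg, h0] using hf i.succ 0
    · left
      obtain ⟨a, ha⟩ := Fin.exists_succ_eq.2 h0
      have hc : ∀ i, f i = ((Fin.cons a g : Fin (k + 1) → Fin n) i).succ :=
        Fin.cases (by simp [ha]) (by simp [hg])
      have cmono : StrictMono (Fin.cons a g : Fin (k + 1) → Fin n) := fun i j hij => by
        simpa [hc] using f.strictMono hij
      refine ⟨OrderEmbedding.ofStrictMono _ cmono, fun i j => ?_⟩
      simp only [OrderEmbedding.coe_ofStrictMono]
      simpa [hc] using hf i j
  · rintro (⟨f, hf⟩ | ⟨g, hg, hg'⟩)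
    · exact ⟨f.trans (Fin.succOrderEmb n), fun i j => by simpa using hf i j⟩
    · have hmono : StrictMono (Fin.cons 0 fun i => (g i).succ : Fin (k + 1) → Fin (n + 1)) := by
        intro i j
        refine Fin.cases ?_ (fun i => ?_) i <;> refine Fin.cases ?_ (fun j => ?_) j <;> simp
      refine ⟨OrderEmbedding.ofStrictMono _ hmono, fun i j => ?_⟩
      simp only [OrderEmbedding.coe_ofStrictMono]
      refine Fin.cases ?_ (fun i => ?_) i <;> refine Fin.cases ?_ (fun j => ?_) j
      · simp
      · have h1 := hg' j
        have h2 : v.succAbove (τ (g j)) ≠ v := Fin.succAbove_ne _ _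
        have h3 : p j.succ ≠ p 0 := by simp
        simp only [Fin.cons_zero, Fin.cons_succ, consPerm_zero, consPerm_succ]
        rw [lt_iff_not_ge, lt_iff_not_ge, le_iff_lt_or_eq, le_iff_lt_or_eq, h1]
        simp [h2]
      · simpa using hg' i
      · simpa using hg i j

/-- Whether `[a, b, c]` is not in strictly decreasing order. -/
def Not321 (a b c : ℕ) : Prop := ¬(c < b ∧ b < a)

/-- Whether `[a, b, c]` is not ordered like `1 3 2`. -/
def Not132 (a b c : ℕ) : Prop := ¬(a < c ∧ c < b)

/-- The reversed positions `n - 1 - σ⁻¹ i`, listed by value `i`. In this list a new first entry of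
value `v` becomes a new maximum, inserted at index `v`, and no other entry changes. -/
def code {n : ℕ} (σ : Equiv.Perm (Fin n)) : List ℕ :=
  List.ofFn fun i => n - 1 - (σ.symm i : ℕ)

@[simp] lemma length_code {n : ℕ} (σ : Equiv.Perm (Fin n)) : (code σ).length = n := by
  simp [code]

lemma code_consPerm {n : ℕ} (v : Fin (n + 1)) (τ : Equiv.Perm (Fin n)) :
    code (consPerm v τ) = (code τ).take v ++ n :: (code τ).drop v := by
  apply List.ext_getElem
  · simp; omega
  · intro i hi _
    have hi' : i < n + 1 := by simpa using hi
    obtain ⟨i, rfl⟩ : ∃ j : Fin (n + 1), i = j := ⟨⟨i, hi'⟩, rfl⟩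
    have hs : (consPerm v τ).symm i = v.insertNth (α := fun _ => Fin (n + 1)) 0
        (fun j => (τ.symm j).succ) i := rfl
    simp only [code, List.getElem_ofFn, Fin.eta, hs]
    rcases Fin.eq_self_or_eq_succAbove v i with rfl | ⟨j, rfl⟩
    · rw [List.getElem_append_right (by simp)]
      simp [min_eq_left (Nat.le_of_lt_succ i.2)]
    · have hv : (v : ℕ) ≤ n := Nat.le_of_lt_succ v.2
      rw [Fin.insertNth_apply_succAbove]
      rcases lt_or_ge j.castSucc v with h | h
      · have h' : (j : ℕ) < v := h
        rw [List.getElem_append_left (by simp [Fin.succAbove_of_castSucc_lt _ _ h]; omega)]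
        simp [Fin.succAbove_of_castSucc_lt _ _ h]
        omega
      · have h' : (v : ℕ) ≤ j := h
        rw [List.getElem_append_right (by simp [Fin.succAbove_of_le_castSucc _ _ h]; omega)]
        simp [Fin.succAbove_of_le_castSucc _ _ h, min_eq_left hv, List.getElem_cons,
          show (j : ℕ) + 1 - v ≠ 0 by omega, show (v : ℕ) + (j + 1 - v - 1) = j by omega]
        omega

/-- The index `v` is an active site of `l`: a new maximum may be inserted there. -/
def IsActive (l : List ℕ) (v : ℕ) : Prop :=
  (l.take v).Triplewise Not321 ∧ (l.drop v).Triplewise Not132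

lemma succAbove_lt_iff {n : ℕ} (v : Fin (n + 1)) (i : Fin n) :
    v.succAbove i < v ↔ (i : ℕ) < v := by
  rw [Fin.succAbove_lt_iff_castSucc_lt]
  rfl

lemma mem_avSet_consPerm {n : ℕ} (v : Fin (n + 1)) (τ : Equiv.Perm (Fin n)) :
    consPerm v τ ∈ avSet (n + 1) ↔ τ ∈ avSet n ∧ IsActive (code τ) v := by
  have hv : (v : ℕ) ≤ n := Nat.le_of_lt_succ v.2
  have hcode : ∀ i (hi : i < (code τ).length),
      (code τ)[i] = n - 1 - τ.symm ⟨i, by simpa using hi⟩ := fun i hi => by simp [code]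
  have h321 : (¬∃ g : Fin 3 ↪o Fin n,
      (∀ i j, τ (g i) < τ (g j) ↔ pattern4123 i.succ < pattern4123 j.succ) ∧
        ∀ i, v.succAbove (τ (g i)) < v ↔ pattern4123 i.succ < pattern4123 0) ↔
      ((code τ).take v).Triplewise Not321 := by
    rw [List.triplewise_iff_getElem]
    simp only [Not321, succAbove_lt_iff, List.getElem_take, hcode]
    constructor
    · rintro h i j k hij hjk hk ⟨h1, h2⟩
      simp only [List.length_take, length_code, lt_min_iff] at hk
      refine h ⟨OrderEmbedding.ofStrictMono
        ![τ.symm ⟨i, by omega⟩, τ.symm ⟨j, by omega⟩, τ.symm ⟨k, by omega⟩] ?_, ?_, ?_⟩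
      · rw [Fin.strictMono_iff_lt_succ]
        intro x
        fin_cases x <;> simp <;> omega
      · intro x y
        fin_cases x <;> fin_cases y <;> simp [pattern4123] <;> omega
      · intro x
        fin_cases x <;> simp [pattern4123] <;> omega
    · rintro h ⟨g, hg, hg'⟩
      have g01 : g 0 < g 1 := by simp
      have g12 : g 1 < g 2 := by simp
      have h01 := (hg 0 1).2 (by decide)
      have h12 := (hg 1 2).2 (by decide)
      have h2 := (hg' 2).2 (by decide)
      refine h (τ (g 0)) (τ (g 1)) (τ (g 2)) h01 h12 (by simp; omega) ?_
      simp only [Fin.eta, Equiv.symm_apply_apply]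
      omega
  have h132 : (¬∃ g : Fin 3 ↪o Fin n,
      (∀ i j, τ (g i) < τ (g j) ↔ pattern1342 i.succ < pattern1342 j.succ) ∧
        ∀ i, v.succAbove (τ (g i)) < v ↔ pattern1342 i.succ < pattern1342 0) ↔
      ((code τ).drop v).Triplewise Not132 := by
    rw [List.triplewise_iff_getElem]
    simp only [Not132, succAbove_lt_iff, List.getElem_drop, hcode]
    constructor
    · rintro h i j k hij hjk hk ⟨h1, h2⟩
      simp only [List.length_drop, length_code] at hk
      refine h ⟨OrderEmbedding.ofStrictMono ![τ.symm ⟨v + j, by omega⟩,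
        τ.symm ⟨v + k, by omega⟩, τ.symm ⟨v + i, by omega⟩] ?_, ?_, ?_⟩
      · rw [Fin.strictMono_iff_lt_succ]
        intro x
        fin_cases x <;> simp <;> omega
      · intro x y
        fin_cases x <;> fin_cases y <;> simp [pattern1342] <;> omega
      · intro x
        fin_cases x <;> simp [pattern1342]
    · rintro h ⟨g, hg, hg'⟩
      have g01 : g 0 < g 1 := by simp
      have g12 : g 1 < g 2 := by simp
      have h20 := (hg 2 0).2 (by decide)
      have h01 := (hg 0 1).2 (by decide)
      have h2 := (hg' 2).not.2 (by decide)
      have e : ∀ i, (v : ℕ) ≤ τ (g i) → (v : ℕ) + (τ (g i) - v) = τ (g i) := by omega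
      refine h (τ (g 2) - v) (τ (g 0) - v) (τ (g 1) - v) (by omega) (by omega)
        (by simp; omega) ?_
      simp only [e 2 (by omega), e 0 (by omega), e 1 (by omega), Fin.eta,
        Equiv.symm_apply_apply]
      omega
  have h4 := permContains_consPerm pattern4123 v τ
  have h1 := permContains_consPerm pattern1342 v τ
  change (¬_ ∧ ¬_) ↔ (¬_ ∧ ¬_) ∧ _ ∧ _
  rw [h4, h1, not_or, not_or, h321, h132]
  tauto

open Classical in
/-- The number of ways to insert `m` new maxima one after the other into `l`, always at an active
site. -/
noncomputable def growCount : ℕ → List ℕ → ℕ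
  | 0, _ => 1
  | m + 1, l => ∑ v ∈ Finset.range (l.length + 1),
      if IsActive l v then growCount m (l.take v ++ l.length :: l.drop v) else 0

open Classical in
/-- Counting the members of length `n + m` by their last `n` entries, up to relative order. -/
lemma avCount_add (m n : ℕ) :
    avCount (n + m) =
      ∑ σ : Equiv.Perm (Fin n), if σ ∈ avSet n then growCount m (code σ) else 0 := by
  induction m generalizing n with
  | zero => simp [avCount, growCount, Set.ncard_eq_toFinset_card']
  | succ m ih =>
    rw [show n + (m + 1) = n + 1 + m by omega, ih,
      ← (Equiv.ofBijective _ (consPerm_bijective n)).sum_comp, Fintype.sum_prod_type_right]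
    refine Finset.sum_congr rfl fun τ _ => ?_
    simp only [Equiv.ofBijective_apply, mem_avSet_consPerm]
    by_cases h : τ ∈ avSet n
    · simp [h, growCount, Finset.sum_range, code_consPerm]
    · simp [h]

lemma avCount_eq_growCount (n : ℕ) : avCount n = growCount n [] := by
  have h0 : ∀ σ : Equiv.Perm (Fin 0), σ ∈ avSet 0 := fun σ =>
    ⟨fun ⟨f, _⟩ => (f 0).elim0, fun ⟨f, _⟩ => (f 0).elim0⟩
  simpa [h0, code] using avCount_add n 0

/-! ### The window of active sites -/

/-- The active sites of `X ++ w ++ Y` are exactly the cuts of the factor `w`: the two ends of `w`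
are active, and `w` cannot be extended on either side. -/
structure Window (X w Y : List ℕ) : Prop where
  left : (X ++ w).Triplewise Not321
  right : (w ++ Y).Triplewise Not132
  left_max : ∀ x ∈ X.getLast?, ¬(x :: (w ++ Y)).Triplewise Not132
  right_max : ∀ y ∈ Y.head?, ¬(X ++ w ++ [y]).Triplewise Not321

lemma Window.isActive_iff {X w Y : List ℕ} (h : Window X w Y) (v : ℕ)
    (hv : v ≤ X.length + w.length + Y.length) :
    IsActive (X ++ w ++ Y) v ↔ X.length ≤ v ∧ v ≤ X.length + w.length := by
  constructor
  · rintro ⟨h1, h2⟩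
    constructor
    · by_contra! hlt
      rcases List.eq_nil_or_concat X with rfl | ⟨X', x, rfl⟩
      · simp at hlt
      · refine h.left_max x (by simp) ?_
        have hle : v ≤ X'.length := by simp at hlt; omega
        rw [List.concat_eq_append, List.append_assoc, List.append_assoc,
          List.drop_append_of_le_length hle] at h2
        simpa using (List.triplewise_append.1 h2).2.1
    · by_contra! hlt
      cases Y with
      | nil => simp at hv; omega
      | cons y Y =>
        refine h.right_max y (by simp) ?_
        obtain ⟨d, hd⟩ : ∃ d, v = (X ++ w ++ [y]).length + d :=
          ⟨v - (X ++ w ++ [y]).length, by simp; omega⟩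
        rw [show X ++ w ++ y :: Y = (X ++ w ++ [y]) ++ Y by simp, hd,
          List.take_length_add_append] at h1
        exact (List.triplewise_append.1 h1).1
  · rintro ⟨h1, h2⟩
    obtain ⟨d, rfl⟩ := Nat.exists_eq_add_of_le h1
    have hd : d ≤ w.length := by omega
    constructor
    · rw [List.append_assoc, List.take_length_add_append, List.take_append_of_le_length hd]
      have := h.left
      rw [← List.take_append_drop d w, ← List.append_assoc] at this
      exact (List.triplewise_append.1 this).1
    · rw [List.append_assoc, List.drop_length_add_append, List.drop_append_of_le_length hd]
      have := h.right
      rw [← List.take_append_drop d w, List.append_assoc] at this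
      exact (List.triplewise_append.1 this).2.1

/-- The sum of `F a b` over the factorizations `w = a ++ b` with `b` nonempty. -/
def splitSum (F : List ℕ → List ℕ → ℕ) (w : List ℕ) : ℕ :=
  ∑ v ∈ Finset.range w.length, F (w.take v) (w.drop v)

lemma splitSum_append (F : List ℕ → List ℕ → ℕ) (A B : List ℕ) :
    splitSum F (A ++ B) =
      splitSum (fun a b => F a (b ++ B)) A + splitSum (fun a b => F (A ++ a) b) B := by
  rw [splitSum, List.length_append, Finset.sum_range_add]
  congr 1
  · refine Finset.sum_congr rfl fun v hv => ?_
    have hv : v ≤ A.length := (Finset.mem_range.1 hv).le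
    rw [List.take_append_of_le_length hv, List.drop_append_of_le_length hv]
  · refine Finset.sum_congr rfl fun v hv => ?_
    rw [List.take_length_add_append, List.drop_length_add_append]

lemma splitSum_singleton (F : List ℕ → List ℕ → ℕ) (x : ℕ) : splitSum F [x] = F [] [x] := by
  simp [splitSum]

lemma splitSum_eq {F : List ℕ → List ℕ → ℕ} {w : List ℕ} {g : ℕ → ℕ}
    (h : ∀ a b, w = a ++ b → b ≠ [] → F a b = g (b.length - 1)) :
    splitSum F w = ∑ q ∈ Finset.range w.length, g q := by
  rw [← Finset.sum_range_reflect, splitSum]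
  refine Finset.sum_congr rfl fun v hv => ?_
  have hv := Finset.mem_range.1 hv
  rw [h _ _ (List.take_append_drop v w).symm (by simpa using hv), List.length_drop]
  congr 1
  omega

lemma Window.growCount_succ {X w Y : List ℕ} (h : Window X w Y) {N : ℕ}
    (hN : N = (X ++ w ++ Y).length) (m : ℕ) :
    growCount (m + 1) (X ++ w ++ Y) =
      splitSum (fun a b => growCount m (X ++ a ++ N :: (b ++ Y))) w +
        growCount m (X ++ w ++ N :: Y) := by
  classical
  have hlen : (X ++ w ++ Y).length + 1 = X.length + (w.length + 1 + Y.length) := by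
    simp; omega
  rw [growCount, hlen, Finset.sum_range_add, Finset.sum_range_add, ← hN]
  have z1 : ∀ v ∈ Finset.range X.length,
      (if IsActive (X ++ w ++ Y) v then
        growCount m ((X ++ w ++ Y).take v ++ N :: (X ++ w ++ Y).drop v) else 0) = 0 := by
    intro v hv
    have hv := Finset.mem_range.1 hv
    rw [if_neg]
    rw [h.isActive_iff v (by omega)]
    omega
  have z2 : ∀ v ∈ Finset.range Y.length,
      (if IsActive (X ++ w ++ Y) (X.length + (w.length + 1 + v)) then
        growCount m ((X ++ w ++ Y).take (X.length + (w.length + 1 + v)) ++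
          N :: (X ++ w ++ Y).drop (X.length + (w.length + 1 + v))) else 0) = 0 := by
    intro v hv
    have hv := Finset.mem_range.1 hv
    rw [if_neg]
    rw [h.isActive_iff _ (by omega)]
    omega
  rw [Finset.sum_eq_zero z1, Finset.sum_eq_zero z2, zero_add, add_zero, Finset.sum_range_succ,
    splitSum]
  congr 1
  · refine Finset.sum_congr rfl fun v hv => ?_
    have hv : v ≤ w.length := (Finset.mem_range.1 hv).le
    rw [if_pos ((h.isActive_iff _ (by omega)).2 (by omega)), List.append_assoc,
      List.take_length_add_append, List.drop_length_add_append,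
      List.take_append_of_le_length hv, List.drop_append_of_le_length hv, List.append_assoc]
  · rw [if_pos ((h.isActive_iff _ (by omega)).2 (by omega)), List.append_assoc,
      List.take_length_add_append, List.drop_length_add_append]
    simp

lemma triplewise_of_sublist {p : ℕ → ℕ → ℕ → Prop} {l₁ l₂ : List ℕ} (h : l₁.Sublist l₂)
    (h₂ : l₂.Triplewise p) : l₁.Triplewise p := by
  induction h with
  | slnil => exact h₂
  | cons x _ ih => exact ih (List.triplewise_cons.1 h₂).2
  | cons_cons x hs ih =>
    rw [List.triplewise_cons] at h₂ ⊢
    exact ⟨h₂.1.sublist hs, ih h₂.2⟩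

lemma triplewise_not321_insert {l b : List ℕ} {N : ℕ} (h : (l ++ b).Triplewise Not321)
    (hb : b.Pairwise (· < ·)) (hN : ∀ x ∈ l, x < N) : (l ++ N :: b).Triplewise Not321 := by
  rw [List.triplewise_append] at h ⊢
  obtain ⟨h1, h2, h3, h4⟩ := h
  refine ⟨h1, List.triplewise_cons.2 ⟨hb.imp fun hxy h => by omega, h2⟩, fun x hx => ?_, ?_⟩
  · exact List.pairwise_cons.2 ⟨fun y _ h => by have := hN x hx; omega, h3 x hx⟩
  · intro y hy
    rcases List.mem_cons.1 hy with rfl | hy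
    · exact List.pairwise_of_forall_mem_list fun x hx z hz h => by have := hN z hz; omega
    · exact h4 y hy

lemma triplewise_not132_insert {a c : List ℕ} {N : ℕ} (h : (a ++ c).Triplewise Not132)
    (hac : ∀ x ∈ a, ∀ y ∈ c, y < x) (hN : ∀ x ∈ a ++ c, x < N) :
    (a ++ N :: c).Triplewise Not132 := by
  rw [List.triplewise_append] at h ⊢
  obtain ⟨h1, h2, h3, h4⟩ := h
  refine ⟨h1, List.triplewise_cons.2 ⟨?_, h2⟩, fun x hx => ?_, ?_⟩
  · exact List.pairwise_of_forall_mem_list fun x hx y hy h => by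
      have := hN y (by simp [hy]); omega
  · exact List.pairwise_cons.2 ⟨fun y hy h => by have := hac x hx y hy; omega, h3 x hx⟩
  · intro y hy
    rcases List.mem_cons.1 hy with rfl | hy
    · exact List.pairwise_of_forall_mem_list fun x hx z hz h => by
        have := hN z (by simp [hz]); omega
    · exact h4 y hy

/-- Inserting a maximum `N` inside the window `u ++ a ++ b ++ u'`, between `a` and `b`, shrinks the
window to `a ++ N :: b` under the stated comparisons. When `u` is nonempty its last entry starts a
`132` with `N`, and when `u'` is nonempty its first entry ends a `321` with `N`, so that the new
window cannot be extended; otherwise the old obstruction persists. -/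
lemma Window.insert {X u a b u' Y : List ℕ} {N : ℕ} (h : Window X (u ++ a ++ b ++ u') Y)
    (hN : ∀ x ∈ X ++ (u ++ a ++ b ++ u') ++ Y, x < N) (hb : b.Pairwise (· < ·))
    (ha : ∀ x ∈ a, ∀ y ∈ b ++ u' ++ Y, y < x)
    (hu : ∀ x ∈ u.getLast?, ∃ y ∈ b ++ u' ++ Y, x < y)
    (hu' : ∀ y ∈ u'.head?, ∃ x ∈ b, y < x) :
    Window (X ++ u) (a ++ N :: b) (u' ++ Y) := by
  obtain ⟨h1, h2, h3, h4⟩ := h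
  constructor
  · rw [← List.append_assoc]
    refine triplewise_not321_insert (triplewise_of_sublist ?_ h1) hb fun x hx => hN x ?_
    · simp only [List.append_assoc, List.append_sublist_append_left]
      simp
    · simp only [List.mem_append] at hx ⊢
      tauto
  · rw [List.append_assoc, List.cons_append]
    refine triplewise_not132_insert (triplewise_of_sublist ?_ h2) ?_ fun x hx => hN x ?_
    · simp [List.append_assoc]
    · simpa [List.append_assoc] using ha
    · simp only [List.mem_append] at hx ⊢
      tauto
  · intro x hx hT
    rcases List.eq_nil_or_concat u with rfl | ⟨u₀, x', rfl⟩
    · refine h3 x (by simpa using hx) (triplewise_of_sublist ?_ hT)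
      simp [List.append_assoc]
    · obtain rfl : x' = x := by simpa using hx
      obtain ⟨y, hy, hxy⟩ := hu x' (by simp)
      have := (List.triplewise_cons.1 hT).1
      rw [List.append_assoc, List.pairwise_append] at this
      refine (List.pairwise_cons.1 this.2.1).1 y (by simpa using hy) ⟨hxy, hN y ?_⟩
      simp only [List.mem_append] at hy ⊢
      tauto
  · intro y hy hT
    cases u' with
    | nil =>
      refine h4 y (by simpa using hy) (triplewise_of_sublist ?_ hT)
      simp [List.append_assoc]
    | cons y' u₀ =>
      obtain rfl : y' = y := by simpa using hy
      obtain ⟨x, hx, hxy⟩ := hu' y' (by simp)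
      rw [show X ++ u ++ (a ++ N :: b) ++ [y'] = (X ++ u ++ a) ++ N :: (b ++ [y']) by simp,
        List.triplewise_append, List.triplewise_cons, List.pairwise_append] at hT
      exact hT.2.1.1.2.2 x hx y' (by simp) ⟨hxy, hN x (by simp [hx])⟩

/-! ### The generating tree -/

/-- The shapes of a window in the generating tree, all of whose runs are increasing; the entries to
the right of the window are called the tail `Y`.
* `one k`: one run `K` of length `k`, above the tail.
* `two l r`: two runs `L ++ R` of lengths `l + 1` and `r + 1`, with `L` above `R` above the tail.
* `three k l r`: three runs `L ++ R ++ K` of lengths `l + 1`, `r + 1`, `k + 1`, with `K` above `L`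
  above `R` above the tail.
* `split p s`: two runs `P ++ S` of lengths `p` and `s + 1`, with `P` above `S` and above the tail,
  and `S` below some entry of the tail. -/
inductive Shape
  | one (k : ℕ)
  | two (l r : ℕ)
  | three (k l r : ℕ)
  | split (p s : ℕ)

open Shape

/-- The sum of `Φ` over the shapes that arise from a given one by inserting a new maximum. -/
def Shape.next {M : Type*} [AddCommMonoid M] (Φ : Shape → M) : Shape → M
  | one k => ∑ q ∈ Finset.range k, Φ (two 0 q) + Φ (one (k + 1))
  | two l r => ∑ q ∈ Finset.range (l + 1), Φ (two 0 q) + Φ (two (l + 1) r) +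
      ∑ q ∈ Finset.range r, Φ (two 0 q) + Φ (three 0 l r)
  | three k l r => ∑ j ∈ Finset.range (l + 1), Φ (split 1 j) +
      ∑ q ∈ Finset.range (k + r + 2), Φ (two 0 q) + Φ (three (k + 1) l r)
  | split p s => ∑ q ∈ Finset.range p, Φ (two 0 q) + Φ (split (p + 1) s) +
      ∑ j ∈ Finset.range s, Φ (split 1 j) + Φ (one 1)

/-- The number of descents of length `m` in the generating tree from a given shape. -/
def Shape.paths : ℕ → Shape → ℕ
  | 0 => fun _ => 1
  | m + 1 => Shape.next (Shape.paths m)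

/-- The window of the list `l`, all of whose entries are below its length, has the given shape. -/
inductive HasShape : List ℕ → Shape → Prop
  | one {X K Y : List ℕ} {k : ℕ} (hN : ∀ x ∈ X ++ K ++ Y, x < (X ++ K ++ Y).length)
      (h : Window X K Y) (hk : K.length = k) (hK : K.Pairwise (· < ·))
      (hKY : ∀ x ∈ K, ∀ y ∈ Y, y < x) : HasShape (X ++ K ++ Y) (one k)
  | two {X L R Y : List ℕ} {l r : ℕ}
      (hN : ∀ x ∈ X ++ (L ++ R) ++ Y, x < (X ++ (L ++ R) ++ Y).length)
      (h : Window X (L ++ R) Y) (hl : L.length = l + 1) (hr : R.length = r + 1)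
      (hL : L.Pairwise (· < ·)) (hR : R.Pairwise (· < ·)) (hLR : ∀ x ∈ L, ∀ y ∈ R, y < x)
      (hY : ∀ x ∈ L ++ R, ∀ y ∈ Y, y < x) : HasShape (X ++ (L ++ R) ++ Y) (two l r)
  | three {X L R K Y : List ℕ} {k l r : ℕ}
      (hN : ∀ x ∈ X ++ (L ++ R ++ K) ++ Y, x < (X ++ (L ++ R ++ K) ++ Y).length)
      (h : Window X (L ++ R ++ K) Y) (hl : L.length = l + 1) (hr : R.length = r + 1)
      (hk : K.length = k + 1) (hL : L.Pairwise (· < ·)) (hR : R.Pairwise (· < ·))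
      (hK : K.Pairwise (· < ·)) (hLR : ∀ x ∈ L, ∀ y ∈ R, y < x)
      (hKLR : ∀ x ∈ K, ∀ y ∈ L ++ R, y < x) (hY : ∀ x ∈ L ++ R ++ K, ∀ y ∈ Y, y < x) :
      HasShape (X ++ (L ++ R ++ K) ++ Y) (three k l r)
  | split {X P S Y : List ℕ} {p s : ℕ}
      (hN : ∀ x ∈ X ++ (P ++ S) ++ Y, x < (X ++ (P ++ S) ++ Y).length)
      (h : Window X (P ++ S) Y) (hp : P.length = p) (hp0 : P ≠ []) (hs : S.length = s + 1)
      (hP : P.Pairwise (· < ·)) (hS : S.Pairwise (· < ·)) (hPS : ∀ x ∈ P, ∀ y ∈ S, y < x)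
      (hPY : ∀ x ∈ P, ∀ y ∈ Y, y < x) (hSY : ∃ y ∈ Y, ∀ x ∈ S, x < y) :
      HasShape (X ++ (P ++ S) ++ Y) (split p s)

/-! ### The children of each shape -/

lemma lt_length_insert {l A B : List ℕ} {N : ℕ} (hl : ∀ x ∈ l, x < N) (hN : N = l.length)
    (h : l = A ++ B) : ∀ x ∈ A ++ N :: B, x < (A ++ N :: B).length := by
  subst h
  intro x hx
  have hlen : (A ++ N :: B).length = N + 1 := by simp [hN]; omega
  rw [hlen]
  rcases List.mem_append.1 hx with hx | hx
  · exact (hl x (by simp [hx])).trans (Nat.lt_succ_self N)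
  · rcases List.mem_cons.1 hx with rfl | hx
    · exact Nat.lt_succ_self _
    · exact (hl x (by simp [hx])).trans (Nat.lt_succ_self N)

/-- A new maximum before an increasing factor `b` of the window that lies above all that follows. -/
lemma hasShape_insert_two {X u b u' Y : List ℕ} {N : ℕ} (h : Window X (u ++ b ++ u') Y)
    (hN : ∀ x ∈ X ++ (u ++ b ++ u') ++ Y, x < N) (hlen : N = (X ++ (u ++ b ++ u') ++ Y).length)
    (hb : b.Pairwise (· < ·)) (hb0 : b ≠ []) (hbY : ∀ x ∈ b, ∀ y ∈ u' ++ Y, y < x)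
    (hu : ∀ x ∈ u.getLast?, ∃ y ∈ b ++ u' ++ Y, x < y) :
    HasShape (X ++ u ++ N :: (b ++ u' ++ Y)) (two 0 (b.length - 1)) := by
  have hpos := List.length_pos_iff.2 hb0
  have key := Window.insert (a := []) (N := N) (by simpa using h) (by simpa using hN) hb (by simp)
    hu (fun y hy => by
      obtain ⟨x, hx⟩ := List.exists_mem_of_ne_nil b hb0
      exact ⟨x, hx, hbY x hx y (by simp [List.mem_of_mem_head? hy])⟩)
  have e : X ++ u ++ N :: (b ++ u' ++ Y) = (X ++ u) ++ ([N] ++ b) ++ (u' ++ Y) := by simp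
  have hlt := lt_length_insert hN hlen (A := X ++ u) (B := b ++ u' ++ Y) (by simp)
  rw [e] at hlt ⊢
  refine .two hlt key rfl (by omega) (by simp) hb ?_ ?_
  · simp only [List.mem_singleton, forall_eq]
    exact fun y hy => hN y (by simp [hy])
  · intro x hx y hy
    rcases List.mem_cons.1 hx with rfl | hx
    · exact hN y (by simp only [List.mem_append] at hy ⊢; tauto)
    · exact hbY x hx y hy

/-- A new maximum before an increasing factor `b` of the window that lies below a later entry. -/
lemma hasShape_insert_split {X u b u' Y : List ℕ} {N : ℕ} (h : Window X (u ++ b ++ u') Y)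
    (hN : ∀ x ∈ X ++ (u ++ b ++ u') ++ Y, x < N) (hlen : N = (X ++ (u ++ b ++ u') ++ Y).length)
    (hb : b.Pairwise (· < ·)) (hb0 : b ≠ []) (hbY : ∃ y ∈ u' ++ Y, ∀ x ∈ b, x < y)
    (hu : ∀ x ∈ u.getLast?, ∃ y ∈ b ++ u' ++ Y, x < y)
    (hu' : ∀ y ∈ u'.head?, ∃ x ∈ b, y < x) :
    HasShape (X ++ u ++ N :: (b ++ u' ++ Y)) (split 1 (b.length - 1)) := by
  have hpos := List.length_pos_iff.2 hb0
  have key := Window.insert (a := []) (N := N) (by simpa using h) (by simpa using hN) hb (by simp)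
    hu hu'
  have e : X ++ u ++ N :: (b ++ u' ++ Y) = (X ++ u) ++ ([N] ++ b) ++ (u' ++ Y) := by simp
  have hlt := lt_length_insert hN hlen (A := X ++ u) (B := b ++ u' ++ Y) (by simp)
  rw [e] at hlt ⊢
  refine .split hlt key rfl (by simp) (by omega) (by simp) hb ?_ ?_ hbY
  · simp only [List.mem_singleton, forall_eq]
    exact fun y hy => hN y (by simp [hy])
  · simp only [List.mem_singleton, forall_eq]
    exact fun y hy => hN y (by simp only [List.mem_append] at hy ⊢; tauto)

lemma exists_lt_of_pairwise_lt {A a b : List ℕ} (hA : A.Pairwise (· < ·)) (h : A = a ++ b)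
    (hb : b ≠ []) : ∀ x ∈ a, ∃ y ∈ b, x < y := by
  subst h
  intro x hx
  obtain ⟨y, hy⟩ := List.exists_mem_of_ne_nil b hb
  exact ⟨y, hy, (List.pairwise_append.1 hA).2.2 x hx y hy⟩

/-- `splitSum_eq` with the factorization `w = [] ++ w` split off. -/
lemma splitSum_eq_add {F : List ℕ → List ℕ → ℕ} {w : List ℕ} {g : ℕ → ℕ} {n : ℕ}
    (hw : w.length = n + 1)
    (h : ∀ a b, w = a ++ b → a ≠ [] → b ≠ [] → F a b = g (b.length - 1)) :
    splitSum F w = F [] w + ∑ q ∈ Finset.range n, g q := by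
  obtain ⟨x, l, rfl⟩ := List.exists_cons_of_length_eq_add_one hw
  obtain rfl : l.length = n := by simpa using hw
  rw [← List.singleton_append, splitSum_append, splitSum_singleton]
  congr 1
  exact splitSum_eq fun a b hab hb => h _ _ (by simp [hab]) (by simp) hb

section
variable {m : ℕ} (ih : ∀ {l : List ℕ} {s : Shape}, HasShape l s → growCount m l = paths m s)
include ih

/-- For one run, the insertion at the right end extends it, and any other one leaves the new maximum
followed by the rest of the run. -/
lemma growCount_one {X K Y : List ℕ} {k : ℕ}
    (hN : ∀ x ∈ X ++ K ++ Y, x < (X ++ K ++ Y).length)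
    (h : Window X K Y) (hk : K.length = k) (hK : K.Pairwise (· < ·))
    (hKY : ∀ x ∈ K, ∀ y ∈ Y, y < x) :
    growCount (m + 1) (X ++ K ++ Y) = paths (m + 1) (one k) := by
  obtain ⟨N, hlen⟩ : ∃ N, N = (X ++ K ++ Y).length := ⟨_, rfl⟩
  rw [← hlen] at hN
  rw [h.growCount_succ hlen]
  subst hk
  simp only [paths, Shape.next]
  congr 1
  · refine splitSum_eq fun a b hab hb => ?_
    subst hab
    rw [← ih (hasShape_insert_two (u := a) (b := b) (u' := []) (N := N) (by simpa using h)
      (by simpa using hN) (by simp [hlen]) (List.pairwise_append.1 hK).2.1 hb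
      (fun x hx y hy => hKY x (by simp [hx]) y (by simpa using hy)) fun x hx => ?_)]
    · simp
    · obtain ⟨y, hy, hxy⟩ := exists_lt_of_pairwise_lt hK rfl hb x (List.mem_of_mem_getLast? hx)
      exact ⟨y, by simp [hy], hxy⟩
  · have key := Window.insert (u := []) (a := K) (b := []) (u' := []) (N := N) (by simpa using h)
      (by simpa using hN) (by simp) (by simpa using hKY) (by simp) (by simp)
    have e : X ++ K ++ N :: Y = (X ++ []) ++ (K ++ N :: []) ++ ([] ++ Y) := by simp
    have hlt := lt_length_insert hN hlen (A := X ++ K) (B := Y) rfl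
    rw [e] at hlt ⊢
    refine ih (.one hlt key (by simp) ?_ ?_)
    · rw [List.pairwise_append]
      refine ⟨hK, by simp, ?_⟩
      simp only [List.mem_singleton, forall_eq]
      exact fun x hx => hN x (by simp [hx])
    · intro x hx y hy
      have hy : y ∈ Y := by simpa using hy
      rcases List.mem_append.1 hx with hx | hx
      · exact hKY x hx y hy
      · rw [List.mem_singleton.1 hx]
        exact hN y (by simp [hy])

/-- For two runs `L ++ R`, the insertion between `L` and `R` extends `L`, the one at the right end
starts a third run, and any other cuts the window down to the rest of a run. -/
lemma growCount_two {X L R Y : List ℕ} {l r : ℕ}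
    (hN : ∀ x ∈ X ++ (L ++ R) ++ Y, x < (X ++ (L ++ R) ++ Y).length)
    (h : Window X (L ++ R) Y) (hl : L.length = l + 1) (hr : R.length = r + 1)
    (hL : L.Pairwise (· < ·)) (hR : R.Pairwise (· < ·)) (hLR : ∀ x ∈ L, ∀ y ∈ R, y < x)
    (hY : ∀ x ∈ L ++ R, ∀ y ∈ Y, y < x) :
    growCount (m + 1) (X ++ (L ++ R) ++ Y) = paths (m + 1) (two l r) := by
  obtain ⟨N, hlen⟩ : ∃ N, N = (X ++ (L ++ R) ++ Y).length := ⟨_, rfl⟩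
  rw [← hlen] at hN
  rw [h.growCount_succ hlen, splitSum_append]
  have hLRY : ∀ x ∈ L, ∀ y ∈ R ++ Y, y < x := fun x hx y hy =>
    (List.mem_append.1 hy).elim (hLR x hx y) (hY x (by simp [hx]) y)
  simp only [paths, Shape.next]
  rw [add_assoc (∑ q ∈ Finset.range (l + 1), _)]
  congr 1
  · congr 1
    · rw [← hl]
      refine splitSum_eq fun a b hab hb => ?_
      subst hab
      rw [← ih (hasShape_insert_two (u := a) (b := b) (u' := R) (N := N) (by simpa using h)
        (by simpa using hN) (by simp [hlen]) (List.pairwise_append.1 hL).2.1 hb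
        (fun x hx y hy => hLRY x (by simp [hx]) y hy) fun x hx => ?_)]
      · obtain ⟨y, hy, hxy⟩ := exists_lt_of_pairwise_lt hL rfl hb x (List.mem_of_mem_getLast? hx)
        exact ⟨y, by simp [hy], hxy⟩
    · rw [splitSum_eq_add (g := fun q => paths m (two 0 q)) hr]
      · congr 1
        have key := Window.insert (u := []) (a := L) (b := R) (u' := []) (N := N)
          (by simpa using h) (by simpa using hN) hR (by simpa using hLRY) (by simp) (by simp)
        have e : X ++ (L ++ []) ++ N :: (R ++ Y) = (X ++ []) ++ ((L ++ [N]) ++ R) ++ ([] ++ Y) := by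
          simp
        have hlt := lt_length_insert hN hlen (A := X ++ (L ++ [])) (B := R ++ Y) (by simp)
        rw [e] at hlt ⊢
        refine ih (.two hlt (by simpa using key) (by simp [hl]) hr ?_ hR ?_ ?_)
        · rw [List.pairwise_append]
          refine ⟨hL, by simp, ?_⟩
          simp only [List.mem_singleton, forall_eq]
          exact fun x hx => hN x (by simp [hx])
        · intro x hx y hy
          rcases List.mem_append.1 hx with hx | hx
          · exact hLR x hx y hy
          · rw [List.mem_singleton.1 hx]
            exact hN y (by simp [hy])
        · intro x hx y hy
          have hy : y ∈ Y := by simpa using hy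
          simp only [List.mem_append, List.mem_singleton] at hx
          rcases hx with (hx | rfl) | hx
          · exact hY x (by simp [hx]) y hy
          · exact hN y (by simp [hy])
          · exact hY x (by simp [hx]) y hy
      · intro a b hab ha hb
        subst hab
        rw [← ih (hasShape_insert_two (u := L ++ a) (b := b) (u' := []) (N := N) (by simpa using h)
          (by simpa using hN) (by simp [hlen]) (List.pairwise_append.1 hR).2.1 hb
          (fun x hx y hy => hY x (by simp [hx]) y (by simpa using hy)) fun x hx => ?_)]
        · simp
        · rw [List.getLast?_append_of_ne_nil _ ha] at hx
          obtain ⟨y, hy, hxy⟩ := exists_lt_of_pairwise_lt hR rfl hb x (List.mem_of_mem_getLast? hx)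
          exact ⟨y, by simp [hy], hxy⟩
  · have key := Window.insert (u := []) (a := L ++ R) (b := []) (u' := []) (N := N)
      (by simpa using h) (by simpa using hN) (by simp) (by simpa using hY) (by simp) (by simp)
    have e : X ++ (L ++ R) ++ N :: Y = (X ++ []) ++ (L ++ R ++ [N]) ++ ([] ++ Y) := by simp
    have hlt := lt_length_insert hN hlen (A := X ++ (L ++ R)) (B := Y) rfl
    rw [e] at hlt ⊢
    refine ih (.three hlt key hl hr rfl hL hR (by simp) hLR ?_ ?_)
    · simp only [List.mem_singleton, forall_eq]
      exact fun x hx => hN x (by simp only [List.mem_append] at hx ⊢; tauto)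
    · intro x hx y hy
      have hy : y ∈ Y := by simpa using hy
      rcases List.mem_append.1 hx with hx | hx
      · exact hY x hx y hy
      · rw [List.mem_singleton.1 hx]
        exact hN y (by simp [hy])

/-- For three runs `L ++ R ++ K`, the insertion at the right end extends `K`. One inside `L` makes
`R ++ K` part of the tail, with `K` above what is left of `L`; one further to the right leaves an
increasing factor of `R ++ K`. -/
lemma growCount_three {X L R K Y : List ℕ} {k l r : ℕ}
    (hN : ∀ x ∈ X ++ (L ++ R ++ K) ++ Y, x < (X ++ (L ++ R ++ K) ++ Y).length)
    (h : Window X (L ++ R ++ K) Y) (hl : L.length = l + 1) (hr : R.length = r + 1)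
    (hk : K.length = k + 1) (hL : L.Pairwise (· < ·)) (hR : R.Pairwise (· < ·))
    (hK : K.Pairwise (· < ·)) (hLR : ∀ x ∈ L, ∀ y ∈ R, y < x)
    (hKLR : ∀ x ∈ K, ∀ y ∈ L ++ R, y < x) (hY : ∀ x ∈ L ++ R ++ K, ∀ y ∈ Y, y < x) :
    growCount (m + 1) (X ++ (L ++ R ++ K) ++ Y) = paths (m + 1) (three k l r) := by
  obtain ⟨N, hlen⟩ : ∃ N, N = (X ++ (L ++ R ++ K) ++ Y).length := ⟨_, rfl⟩
  rw [← hlen] at hN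
  obtain ⟨z, hz⟩ : ∃ z, z ∈ K := List.exists_mem_of_length_pos (by omega)
  obtain ⟨r₀, R₀, hR₀⟩ := List.exists_cons_of_length_eq_add_one hr
  have hRK : (R ++ K).Pairwise (· < ·) :=
    List.pairwise_append.2 ⟨hR, hK, fun x hx y hy => hKLR y hy x (by simp [hx])⟩
  rw [h.growCount_succ hlen, List.append_assoc L, splitSum_append]
  simp only [paths, Shape.next]
  congr 1
  · congr 1
    · rw [← hl]
      refine splitSum_eq fun a b hab hb => ?_
      subst hab
      obtain ⟨x₀, hx₀⟩ := List.exists_mem_of_ne_nil b hb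
      rw [← ih (hasShape_insert_split (u := a) (b := b) (u' := R ++ K) (N := N) (by simpa using h)
        (by simpa using hN) (by simp [hlen]) (List.pairwise_append.1 hL).2.1 hb
        ⟨z, by simp [hz], fun x hx => hKLR z hz x (by simp [hx])⟩ (fun x hx => ?_)
        fun y hy => ⟨x₀, hx₀, hLR x₀ (by simp [hx₀]) y ?_⟩)]
      · obtain ⟨y, hy, hxy⟩ := exists_lt_of_pairwise_lt hL rfl hb x (List.mem_of_mem_getLast? hx)
        exact ⟨y, by simp [hy], hxy⟩
      · subst hR₀
        have : r₀ = y := by simpa using hy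
        simp [this]
    · rw [show k + r + 2 = (R ++ K).length by simp [hr, hk]; omega]
      refine splitSum_eq fun a b hab hb => ?_
      have hsub : ∀ x, x ∈ a ∨ x ∈ b → x ∈ R ∨ x ∈ K := fun x hx => by
        rwa [← List.mem_append, hab, List.mem_append]
      rw [List.append_assoc L, hab] at h hN hlen
      rw [← ih (hasShape_insert_two (u := L ++ a) (b := b) (u' := []) (N := N) (by simpa using h)
        (by simpa using hN) (by simp [hlen]) (List.pairwise_append.1 (hab ▸ hRK)).2.1 hb
        (fun x hx y hy => hY x ?_ y (by simpa using hy)) fun x hx => ?_)]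
      · simp
      · have := hsub x (.inr hx)
        simp only [List.mem_append]
        tauto
      · by_cases ha : a = []
        · subst ha
          have hx : x ∈ L := List.mem_of_mem_getLast? (by simpa using hx)
          refine ⟨z, ?_, hKLR z hz x (by simp [hx])⟩
          have : z ∈ R ++ K := by simp [hz]
          rw [hab] at this
          simpa using .inl this
        · rw [List.getLast?_append_of_ne_nil _ ha] at hx
          obtain ⟨y, hy, hxy⟩ :=
            exists_lt_of_pairwise_lt hRK hab hb x (List.mem_of_mem_getLast? hx)
          exact ⟨y, by simp [hy], hxy⟩
  · have key := Window.insert (u := []) (a := L ++ R ++ K) (b := []) (u' := []) (N := N)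
      (by simpa using h) (by simpa using hN) (by simp) (by simpa using hY) (by simp) (by simp)
    have e : X ++ (L ++ (R ++ K)) ++ N :: Y = (X ++ []) ++ (L ++ R ++ (K ++ [N])) ++ ([] ++ Y) := by
      simp
    have hlt := lt_length_insert hN hlen (A := X ++ (L ++ (R ++ K))) (B := Y) (by simp)
    rw [e] at hlt ⊢
    refine ih (.three hlt (by simpa using key) hl hr (by simp [hk]) hL hR ?_ hLR ?_ ?_)
    · rw [List.pairwise_append]
      refine ⟨hK, by simp, ?_⟩
      simp only [List.mem_singleton, forall_eq]
      exact fun x hx => hN x (by simp [hx])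
    · intro x hx y hy
      rcases List.mem_append.1 hx with hx | hx
      · exact hKLR x hx y hy
      · rw [List.mem_singleton.1 hx]
        exact hN y (by simp only [List.mem_append] at hy ⊢; tauto)
    · intro x hx y hy
      have hy : y ∈ Y := by simpa using hy
      rw [← List.append_assoc] at hx
      rcases List.mem_append.1 hx with hx | hx
      · exact hY x hx y hy
      · rw [List.mem_singleton.1 hx]
        exact hN y (by simp [hy])

/-- For `P ++ S`, the insertion between the runs extends `P`. One inside `P` pushes `S` into the
tail, and one inside `S` or at the right end discards `P`, since the tail exceeds `S`. -/
lemma growCount_split {X P S Y : List ℕ} {p s : ℕ}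
    (hN : ∀ x ∈ X ++ (P ++ S) ++ Y, x < (X ++ (P ++ S) ++ Y).length)
    (h : Window X (P ++ S) Y) (hp : P.length = p) (hp0 : P ≠ []) (hs : S.length = s + 1)
    (hP : P.Pairwise (· < ·)) (hS : S.Pairwise (· < ·)) (hPS : ∀ x ∈ P, ∀ y ∈ S, y < x)
    (hPY : ∀ x ∈ P, ∀ y ∈ Y, y < x) (hSY : ∃ y ∈ Y, ∀ x ∈ S, x < y) :
    growCount (m + 1) (X ++ (P ++ S) ++ Y) = paths (m + 1) (split p s) := by
  obtain ⟨N, hlen⟩ : ∃ N, N = (X ++ (P ++ S) ++ Y).length := ⟨_, rfl⟩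
  rw [← hlen] at hN
  obtain ⟨z, hz, hSz⟩ := hSY
  have hS0 : S ≠ [] := by rintro rfl; simp at hs
  rw [h.growCount_succ hlen, splitSum_append]
  have hPSY : ∀ x ∈ P, ∀ y ∈ S ++ Y, y < x := fun x hx y hy =>
    (List.mem_append.1 hy).elim (hPS x hx y) (hPY x hx y)
  simp only [paths, Shape.next]
  rw [add_assoc (∑ q ∈ Finset.range p, _)]
  congr 1
  · congr 1
    · rw [← hp]
      refine splitSum_eq fun a b hab hb => ?_
      subst hab
      rw [← ih (hasShape_insert_two (u := a) (b := b) (u' := S) (N := N) (by simpa using h)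
        (by simpa using hN) (by simp [hlen]) (List.pairwise_append.1 hP).2.1 hb
        (fun x hx y hy => hPSY x (by simp [hx]) y hy) fun x hx => ?_)]
      · obtain ⟨y, hy, hxy⟩ := exists_lt_of_pairwise_lt hP rfl hb x (List.mem_of_mem_getLast? hx)
        exact ⟨y, by simp [hy], hxy⟩
    · rw [splitSum_eq_add (g := fun q => paths m (split 1 q)) hs]
      · congr 1
        have key := Window.insert (u := []) (a := P) (b := S) (u' := []) (N := N)
          (by simpa using h) (by simpa using hN) hS (by simpa using hPSY) (by simp) (by simp)
        have e : X ++ (P ++ []) ++ N :: (S ++ Y) = (X ++ []) ++ ((P ++ [N]) ++ S) ++ ([] ++ Y) := by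
          simp
        have hlt := lt_length_insert hN hlen (A := X ++ (P ++ [])) (B := S ++ Y) (by simp)
        rw [e] at hlt ⊢
        refine ih (.split hlt (by simpa using key) (by simp [hp]) (by simp) hs ?_ hS ?_ ?_
          ⟨z, by simp [hz], hSz⟩)
        · rw [List.pairwise_append]
          refine ⟨hP, by simp, ?_⟩
          simp only [List.mem_singleton, forall_eq]
          exact fun x hx => hN x (by simp [hx])
        · intro x hx y hy
          rcases List.mem_append.1 hx with hx | hx
          · exact hPS x hx y hy
          · rw [List.mem_singleton.1 hx]
            exact hN y (by simp [hy])
        · intro x hx y hy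
          have hy : y ∈ Y := by simpa using hy
          rcases List.mem_append.1 hx with hx | hx
          · exact hPY x hx y hy
          · rw [List.mem_singleton.1 hx]
            exact hN y (by simp [hy])
      · intro a b hab ha hb
        subst hab
        rw [← ih (hasShape_insert_split (u := P ++ a) (b := b) (u' := []) (N := N)
          (by simpa using h) (by simpa using hN) (by simp [hlen]) (List.pairwise_append.1 hS).2.1 hb
          ⟨z, by simp [hz], fun x hx => hSz x (by simp [hx])⟩ (fun x hx => ?_) (by simp))]
        · simp
        · rw [List.getLast?_append_of_ne_nil _ ha] at hx
          exact ⟨z, by simp [hz], hSz x (by simp [List.mem_of_mem_getLast? hx])⟩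
  · have hu : ∀ x ∈ (P ++ S).getLast?, ∃ y ∈ [] ++ [] ++ Y, x < y := fun x hx => by
      rw [List.getLast?_append_of_ne_nil _ hS0] at hx
      exact ⟨z, by simp [hz], hSz x (List.mem_of_mem_getLast? hx)⟩
    have key := Window.insert (u := P ++ S) (a := []) (b := []) (u' := []) (N := N)
      (by simpa using h) (by simpa using hN) (by simp) (by simp) hu (by simp)
    have hlt := lt_length_insert hN hlen (A := X ++ (P ++ S)) (B := Y) rfl
    have e : X ++ (P ++ S) ++ N :: Y = (X ++ (P ++ S)) ++ [N] ++ Y := by simp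
    rw [e] at hlt ⊢
    refine ih (.one hlt key rfl (by simp) ?_)
    simp only [List.mem_singleton, forall_eq]
    exact fun y hy => hN y (by simp [hy])

end

/-- The window shapes describe the whole growth of a list. -/
theorem HasShape.growCount_eq {l : List ℕ} {s : Shape} (h : HasShape l s) (m : ℕ) :
    growCount m l = paths m s := by
  induction m generalizing l s with
  | zero => rfl
  | succ m ih =>
    cases h with
    | one hN h hk hK hKY => exact growCount_one ih hN h hk hK hKY
    | two hN h hl hr hL hR hLR hY => exact growCount_two ih hN h hl hr hL hR hLR hY
    | three hN h hl hr hk hL hR hK hLR hKLR hY =>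
      exact growCount_three ih hN h hl hr hk hL hR hK hLR hKLR hY
    | split hN h hp hp0 hs hP hS hPS hPY hSY =>
      exact growCount_split ih hN h hp hp0 hs hP hS hPS hPY hSY

lemma avCount_eq_paths (n : ℕ) : avCount n = paths n (one 0) := by
  rw [avCount_eq_growCount]
  exact HasShape.growCount_eq (.one (X := []) (K := []) (Y := []) (by simp)
    ⟨by simp, by simp, by simp, by simp⟩ rfl (by simp) (by simp)) n

/-! ### The generating function -/

lemma Shape.next_map {M N : Type*} [AddCommMonoid M] [AddCommMonoid N] (f : M →+ N)
    (Φ : Shape → M) (s : Shape) : f (Shape.next Φ s) = Shape.next (fun t => f (Φ t)) s := by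
  cases s <;> simp [Shape.next, map_sum]

lemma Shape.next_sub {M : Type*} [AddCommGroup M] (Φ Ψ : Shape → M) (s : Shape) :
    Shape.next (fun t => Φ t - Ψ t) s = Shape.next Φ s - Shape.next Ψ s := by
  cases s <;> simp only [Shape.next, Finset.sum_sub_distrib] <;> abel

/-- The generating function of the descents from a given shape, by length. -/
noncomputable def Shape.genFun (s : Shape) : PowerSeries ℤ :=
  PowerSeries.mk fun n => (paths n s : ℤ)

lemma Shape.genFun_eq (s : Shape) :
    genFun s = 1 + PowerSeries.X * Shape.next genFun s := by
  ext n
  cases n with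
  | zero => simp [genFun, paths]
  | succ n =>
    have h := Shape.next_map (PowerSeries.coeff (R := ℤ) n).toAddMonoidHom genFun s
    have h' := Shape.next_map (Nat.castAddMonoidHom ℤ) (paths n) s
    simp only [LinearMap.toAddMonoidHom_coe, genFun, PowerSeries.coeff_mk,
      Nat.coe_castAddMonoidHom] at h h'
    rw [map_add, PowerSeries.coeff_succ_X_mul]
    simp only [genFun, PowerSeries.coeff_mk, PowerSeries.coeff_one, paths, h, h']
    simp

/-- The recursion of the generating tree determines its solution up to the constant term. -/
lemma Shape.eq_mul_genFun {c : PowerSeries ℤ} {Φ : Shape → PowerSeries ℤ}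
    (hΦ : ∀ s, Φ s = c + PowerSeries.X * Shape.next Φ s) (s : Shape) : Φ s = c * genFun s := by
  set E : Shape → PowerSeries ℤ := fun s => Φ s - c * genFun s with hE
  have hrec : ∀ s, E s = PowerSeries.X * Shape.next E s := by
    intro s
    have h := Shape.next_map (AddMonoidHom.mulLeft c) genFun s
    simp only [AddMonoidHom.coe_mulLeft] at h
    rw [hE, Shape.next_sub, ← h]
    simp only
    nth_rewrite 1 [hΦ s, genFun_eq s]
    ring
  have hzero : ∀ n s, PowerSeries.coeff n (E s) = 0 := by
    intro n
    induction n with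
    | zero => intro s; rw [hrec]; simp
    | succ n ih =>
      intro s
      have h := Shape.next_map (PowerSeries.coeff (R := ℤ) n).toAddMonoidHom E s
      simp only [LinearMap.toAddMonoidHom_coe, ih] at h
      rw [hrec, PowerSeries.coeff_succ_X_mul, h]
      cases s <;> simp [Shape.next]
  exact sub_eq_zero.1 (PowerSeries.ext fun n => (hzero n s).trans (map_zero _).symm)

section ClosedForm

variable {R : Type*} [CommRing R]

/-- The coefficient of the powers of the Catalan series in the solution of the recursion. -/
def catalanCoeff (z : R) : R := 1 - 3 * z + 3 * z ^ 2

/-- The common denominator of the generating functions of all shapes. -/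
def denom (z C : R) : R :=
  (1 - z) * (1 - 2 * z) - ((1 - z) * C ^ 2 - 1) * ((1 - z) ^ 2 * (1 - 2 * z) + z ^ 2)

/-- `denom` times the generating function of a shape, in terms of the variable `z`, the Catalan
series `C`, and the inverses `I` of `1 - z` and `H` of `1 - 2 * z`. -/
def closedForm (z C I H : R) : Shape → R
  | one k => denom z C * I + catalanCoeff z * (C ^ (k + 1) - I)
  | two l r => catalanCoeff z * C ^ (r + 2) + catalanCoeff z * (C ^ (l + 2) - C ^ 2) +
      z * (denom z C * I + catalanCoeff z * (C ^ 2 - I)) * H * (I ^ (l + 1) - I)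
  | three k l r =>
      I * (denom z C + (denom z C * I + catalanCoeff z * (C ^ 2 - I)) * (I ^ (l + 1) - 1)) +
        catalanCoeff z * (C ^ (k + r + 3) - I)
  | split p s => (denom z C * I + catalanCoeff z * (C ^ 2 - I)) * I ^ (s + 1) +
      catalanCoeff z * (C ^ (p + 1) - C ^ 2)

variable {z C I H : R}

lemma mul_sum_two (hC : C = 1 + z * C ^ 2) (k : ℕ) :
    z * ∑ q ∈ Finset.range k, closedForm z C I H (two 0 q) = catalanCoeff z * (C ^ k - 1) := by
  induction k with
  | zero => simp
  | succ k ih =>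
    rw [Finset.sum_range_succ, mul_add, ih]
    simp only [closedForm]
    linear_combination (-catalanCoeff z * C ^ k) * hC

lemma mul_sum_split (hI : (1 - z) * I = 1) (l : ℕ) :
    z * ∑ j ∈ Finset.range l, closedForm z C I H (split 1 j) =
      (denom z C * I + catalanCoeff z * (C ^ 2 - I)) * (I ^ l - 1) := by
  induction l with
  | zero => simp
  | succ l ih =>
    rw [Finset.sum_range_succ, mul_add, ih]
    simp only [closedForm]
    linear_combination (-(denom z C * I + catalanCoeff z * (C ^ 2 - I)) * I ^ l) * hI

/-- The relation between `denom` and `catalanCoeff` that makes the constant terms of `closedForm`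
agree in the recursion for `two`. -/
lemma denom_relation (hC : C = 1 + z * C ^ 2) (hI : (1 - z) * I = 1) (hH : (1 - 2 * z) * H = 1) :
    denom z C * (1 + z * I) + catalanCoeff z * (C ^ 2 - C - 1 - z * I) +
      z * I * (denom z C * I + catalanCoeff z * (C ^ 2 - I)) * ((1 - z) * H - 1) = 0 := by
  have hI0 : IsUnit (1 - z) := IsUnit.of_mul_eq_one _ hI
  have hH0 : IsUnit (1 - 2 * z) := IsUnit.of_mul_eq_one _ hH
  simp only [denom, catalanCoeff]
  grind

lemma closedForm_eq (hC : C = 1 + z * C ^ 2) (hI : (1 - z) * I = 1) (hH : (1 - 2 * z) * H = 1)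
    (s : Shape) :
    closedForm z C I H s = denom z C + z * Shape.next (closedForm z C I H) s := by
  have hT := mul_sum_two (I := I) (H := H) hC
  have hM := mul_sum_split (C := C) (H := H) hI
  cases s with
  | one k =>
    simp only [Shape.next, mul_add, hT]
    simp only [closedForm]
    set d := denom z C
    set a := catalanCoeff z
    linear_combination (a * C ^ k) * hC + (d - a) * hI
  | two l r =>
    simp only [Shape.next, mul_add, hT]
    simp only [closedForm]
    have h := denom_relation hC hI hH
    have hHI : H - z * H * I = I := by linear_combination I * hH - H * hI
    set d := denom z C
    set a := catalanCoeff z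
    set μ := d * I + a * (C ^ 2 - I)
    linear_combination (a * C ^ (l + 1) + a * C ^ r * (C + 1) - a) * hC +
      z * μ * I ^ (l + 1) * hHI - h
  | three k l r =>
    simp only [Shape.next, mul_add, hT, hM]
    simp only [closedForm]
    set d := denom z C
    set a := catalanCoeff z
    grind
  | split p s =>
    simp only [Shape.next, mul_add, hT, hM]
    simp only [closedForm]
    set d := denom z C
    set a := catalanCoeff z
    grind

end ClosedForm

open PowerSeries in
/-- The square root `√(1 - 4 X) = 1 - 2 X C` in terms of the Catalan series `C`. -/
noncomputable def sqrtSeries : PowerSeries ℤ :=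
  1 - 2 * X * catalanSeries.map (Nat.castRingHom ℤ)

open PowerSeries in
lemma catalanSeries_map_eq :
    catalanSeries.map (Nat.castRingHom ℤ) = 1 + X * catalanSeries.map (Nat.castRingHom ℤ) ^ 2 := by
  have h := congrArg (PowerSeries.map (Nat.castRingHom ℤ)) catalanSeries_sq_mul_X_add_one
  simp only [map_add, map_mul, map_pow, map_one, PowerSeries.map_X] at h
  linear_combination -h

lemma constantCoeff_sqrtSeries : PowerSeries.constantCoeff sqrtSeries = 1 := by
  simp [sqrtSeries]

lemma sqrtSeries_sq : sqrtSeries ^ 2 = 1 - 4 * PowerSeries.X := by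
  simp only [sqrtSeries]
  linear_combination (-4 * PowerSeries.X) * catalanSeries_map_eq

open PowerSeries in
lemma coe_denomP3 : (denomP3 : PowerSeries ℤ) = 2 - 22 * X + 96 * X ^ 2 - 220 * X ^ 3
    + 282 * X ^ 4 - 196 * X ^ 5 + 64 * X ^ 6 - 8 * X ^ 7 := by
  have h (n : ℕ) [n.AtLeastTwo] : ((OfNat.ofNat n : Polynomial ℤ) : PowerSeries ℤ) =
      OfNat.ofNat n := map_ofNat Polynomial.coeToPowerSeries.ringHom n
  simp [denomP3, h]

open PowerSeries in
lemma denomP3_mul_genFunP3_sub_one :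
    (denomP3 : PowerSeries ℤ) * (genFunP3 - 1) = numerP3 sqrtSeries := by
  set C : PowerSeries ℤ := catalanSeries.map (Nat.castRingHom ℤ) with hCdef
  have hC : C = 1 + X * C ^ 2 := catalanSeries_map_eq
  obtain ⟨I, hI⟩ : ∃ I : PowerSeries ℤ, (1 - X) * I = 1 :=
    (isUnit_iff_constantCoeff.2 (by simp)).exists_right_inv
  obtain ⟨H, hH⟩ : ∃ H : PowerSeries ℤ, (1 - 2 * X) * H = 1 :=
    (isUnit_iff_constantCoeff.2 (by simp)).exists_right_inv
  have hP : genFunP3 = Shape.genFun (one 0) := by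
    ext n
    simp [genFunP3, Shape.genFun, avCount_eq_paths]
  have key := Shape.eq_mul_genFun (closedForm_eq hC hI hH) (one 0)
  rw [← hP] at key
  have hd : denom (X : PowerSeries ℤ) C ≠ 0 := by
    intro h
    have h0 : constantCoeff C = 1 := by
      rw [hC]
      simp
    have := congrArg constantCoeff h
    simp [denom, h0] at this
  refine mul_left_cancel₀ hd ?_
  rw [coe_denomP3, numerP3, sqrtSeries, ← hCdef]
  simp only [closedForm, zero_add, pow_one] at key
  set z : PowerSeries ℤ := X
  -- `denom - catalanCoeff` is divisible by `1 - X`, which removes the factor `I`.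
  have key' : denom z C * genFunP3 = (1 - 2 * z) * (1 - z)
      - C ^ 2 * (1 - 4 * z + 6 * z ^ 2 - 2 * z ^ 3) + catalanCoeff z * C := by
    rw [← key]
    simp only [denom, catalanCoeff]
    linear_combination ((1 - 2 * z) * (1 - z) - C ^ 2 * (1 - 4 * z + 6 * z ^ 2 - 2 * z ^ 3)) * hI
  have expand : ∀ D : PowerSeries ℤ, denom z C * (D * (genFunP3 - 1)) =
      D * (denom z C * genFunP3 - denom z C) := fun D => by ring
  rw [expand, key']
  simp only [denom, catalanCoeff]
  -- The cofactor is the quotient of the difference of the two sides by `X C² - C + 1`.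
  linear_combination (-((-2 + 26 * z - 150 * z ^ 2 + 504 * z ^ 3 - 1080 * z ^ 4 + 1516 * z ^ 5
    - 1372 * z ^ 6 + 752 * z ^ 7 - 216 * z ^ 8 + 24 * z ^ 9) + (-2 * z + 22 * z ^ 2 - 108 * z ^ 3
    + 306 * z ^ 4 - 542 * z ^ 5 + 608 * z ^ 6 - 416 * z ^ 7 + 156 * z ^ 8 - 24 * z ^ 9) * C)) * hC

/-! ### Power series evaluated inside their disc of convergence -/

/-- The power series `f` converges (absolutely) at `t` with value `v`. -/
def HasEval (t : ℝ) (f : PowerSeries ℝ) (v : ℝ) : Prop :=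
  HasSum (fun n => PowerSeries.coeff n f * t ^ n) v

namespace HasEval

variable {t : ℝ} {f g : PowerSeries ℝ} {v w : ℝ}

lemma add (hf : HasEval t f v) (hg : HasEval t g w) : HasEval t (f + g) (v + w) := by
  simpa [HasEval, add_mul] using HasSum.add hf hg

lemma sub (hf : HasEval t f v) (hg : HasEval t g w) : HasEval t (f - g) (v - w) := by
  simpa [HasEval, sub_mul] using HasSum.sub hf hg

lemma mul (hf : HasEval t f v) (hg : HasEval t g w) : HasEval t (f * g) (v * w) := by
  have hf' := hf.summable.norm
  have hg' := hg.summable.norm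
  have e : (fun n => PowerSeries.coeff n (f * g) * t ^ n) = fun n =>
      ∑ p ∈ Finset.HasAntidiagonal.antidiagonal n, (PowerSeries.coeff p.1 f * t ^ p.1) *
        (PowerSeries.coeff p.2 g * t ^ p.2) := by
    ext n
    rw [PowerSeries.coeff_mul, Finset.sum_mul]
    refine Finset.sum_congr rfl fun p hp => ?_
    rw [← Finset.HasAntidiagonal.mem_antidiagonal.1 hp, pow_add]
    ring
  have hs := (summable_norm_sum_mul_antidiagonal_of_summable_norm hf' hg').of_norm
  have ht := tsum_mul_tsum_eq_tsum_sum_antidiagonal_of_summable_norm hf' hg'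
  rw [HasSum.tsum_eq hf, HasSum.tsum_eq hg] at ht
  rw [HasEval, e, ht]
  exact hs.hasSum

lemma const (c : ℝ) : HasEval t (PowerSeries.C c) c := by
  have := hasSum_ite_eq (0 : ℕ) c
  refine this.congr_fun fun n => ?_
  cases n <;> simp [PowerSeries.coeff_C]

lemma ofNat (n : ℕ) [n.AtLeastTwo] :
    HasEval t (OfNat.ofNat n : PowerSeries ℝ) (OfNat.ofNat n : ℝ) := by
  have := const (t := t) (OfNat.ofNat n : ℝ)
  rwa [map_ofNat] at this

lemma one : HasEval t 1 1 := by
  have := const (t := t) 1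
  rwa [map_one] at this

lemma X : HasEval t PowerSeries.X t := by
  have := hasSum_ite_eq (1 : ℕ) t
  refine this.congr_fun fun n => ?_
  by_cases h : n = 1 <;> simp [PowerSeries.coeff_X, h]

lemma pow (hf : HasEval t f v) (n : ℕ) : HasEval t (f ^ n) (v ^ n) := by
  induction n with
  | zero => simpa using one
  | succ n ih => simpa [pow_succ] using ih.mul hf

end HasEval

/-- The partial sum of length `N` of `∑ |fₙ| tⁿ`. -/
noncomputable def truncNorm (t : ℝ) (N : ℕ) (f : PowerSeries ℝ) : ℝ :=
  ∑ n ∈ Finset.range N, |PowerSeries.coeff n f| * t ^ n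

section truncNorm
variable {t : ℝ} (ht : 0 ≤ t) (N : ℕ)
include ht

lemma truncNorm_nonneg (f : PowerSeries ℝ) : 0 ≤ truncNorm t N f :=
  Finset.sum_nonneg fun _ _ => by positivity

lemma truncNorm_add_le (f g : PowerSeries ℝ) :
    truncNorm t N (f + g) ≤ truncNorm t N f + truncNorm t N g := by
  rw [truncNorm, truncNorm, truncNorm, ← Finset.sum_add_distrib]
  refine Finset.sum_le_sum fun n _ => ?_
  rw [map_add, ← add_mul]
  gcongr
  exact abs_add_le _ _

lemma truncNorm_mul_le (f g : PowerSeries ℝ) :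
    truncNorm t N (f * g) ≤ truncNorm t N f * truncNorm t N g := by
  let F : ℕ → ℕ → ℝ := fun i j =>
    (|PowerSeries.coeff i f| * t ^ i) * (|PowerSeries.coeff j g| * t ^ j)
  have hF : ∀ i j, 0 ≤ F i j := fun i j => by positivity
  calc truncNorm t N (f * g)
      ≤ ∑ n ∈ Finset.range N, ∑ i ∈ Finset.range (n + 1), F i (n - i) := by
        refine Finset.sum_le_sum fun n _ => ?_
        rw [PowerSeries.coeff_mul, ← Finset.Nat.sum_antidiagonal_eq_sum_range_succ F n]
        calc _ ≤ (∑ p ∈ Finset.HasAntidiagonal.antidiagonal n,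
              |PowerSeries.coeff p.1 f * PowerSeries.coeff p.2 g|) * t ^ n := by
              gcongr
              exact Finset.abs_sum_le_sum_abs _ _
          _ = _ := by
              rw [Finset.sum_mul]
              refine Finset.sum_congr rfl fun p hp => ?_
              rw [← Finset.HasAntidiagonal.mem_antidiagonal.1 hp, pow_add, abs_mul]
              ring
    _ = ∑ i ∈ Finset.range N, ∑ j ∈ Finset.range (N - i), F i j :=
        Finset.sum_range_diag_flip N F
    _ ≤ ∑ i ∈ Finset.range N, ∑ j ∈ Finset.range N, F i j := by
        refine Finset.sum_le_sum fun i _ => ?_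
        exact Finset.sum_le_sum_of_subset_of_nonneg
          (Finset.range_subset_range.2 (Nat.sub_le _ _)) fun j _ _ => hF i j
    _ = _ := by rw [truncNorm, truncNorm, Finset.sum_mul_sum]

omit ht in
lemma truncNorm_C_mul (c : ℝ) (f : PowerSeries ℝ) :
    truncNorm t N (PowerSeries.C c * f) = |c| * truncNorm t N f := by
  simp [truncNorm, Finset.mul_sum, abs_mul, mul_assoc]

lemma truncNorm_le_of_hasEval {f : PowerSeries ℝ} {v : ℝ} (hf : HasEval t f v) :
    truncNorm t N f ≤ ∑' n, |PowerSeries.coeff n f * t ^ n| := by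
  have h := (HasSum.summable hf).abs
  calc truncNorm t N f = ∑ n ∈ Finset.range N, |PowerSeries.coeff n f * t ^ n| := by
        refine Finset.sum_congr rfl fun n _ => ?_
        rw [abs_mul, abs_of_nonneg (pow_nonneg ht n)]
    _ ≤ _ := h.sum_le_tsum _ fun n _ => abs_nonneg _

lemma exists_hasEval_of_truncNorm_le {f : PowerSeries ℝ} {M : ℝ}
    (h : ∀ N, truncNorm t N f ≤ M) : ∃ v, HasEval t f v := by
  have : Summable fun n => |PowerSeries.coeff n f * t ^ n| := by
    refine summable_of_sum_range_le (c := M) (fun n => abs_nonneg _) fun N => ?_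
    refine le_trans (le_of_eq ?_) (h N)
    refine Finset.sum_congr rfl fun n _ => ?_
    rw [abs_mul, abs_of_nonneg (pow_nonneg ht n)]
  exact ⟨_, this.of_abs.hasSum⟩

end truncNorm

/-! ### The dominant root of the denominator -/

section Multiplier

variable {A : Type*} [CommRing A]

/-- The polynomial `denomP3` as a function on a commutative ring. -/
def denomFun (x : A) : A :=
  2 - 22 * x + 96 * x ^ 2 - 220 * x ^ 3 + 282 * x ^ 4 - 196 * x ^ 5 + 64 * x ^ 6 - 8 * x ^ 7

/-- A polynomial with positive coefficients, obtained by truncating and rounding the expansion of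
`20 (1 - X / z) / denomP3` at the origin for the root `z ≈ 0.239788`, so that its product with
`denomP3` is close to the linear polynomial `20 (1 - X / z)` on the disc of radius `1 / 4`. -/
def multiplierFun (x : A) : A :=
  10 + 68 * x + 271 * x ^ 2 + 806 * x ^ 3 + 1944 * x ^ 4 + 3904 * x ^ 5 + 6368 * x ^ 6
    + 7365 * x ^ 7

/-- The coefficients of the product of `denomFun` and `multiplierFun`. -/
def prodCoeff (k : ℕ) : ℤ :=
  [20, -84, 6, -22, 32, 12, -114, 186, -2550, 75400, -471740, 1063106, -1067220, 420416,
    -58920].getD k 0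

lemma sum_prodCoeff (x : A) :
    ∑ k ∈ Finset.range 15, (prodCoeff k : A) * x ^ k = denomFun x * multiplierFun x := by
  simp only [Finset.sum_range_succ, Finset.sum_range_zero, prodCoeff, denomFun, multiplierFun,
    List.getD_cons_zero, List.getD_cons_succ]
  push_cast
  ring

/-- The quotient by `x - y` of the difference of the values of `denomFun * multiplierFun` at `x`
and `y`. -/
def prodQuotient (x y : A) : A :=
  ∑ k ∈ Finset.range 14, (prodCoeff (k + 1) : A) * ∑ i ∈ Finset.range (k + 1), x ^ i * y ^ (k - i)

lemma sub_mul_prodQuotient (x y : A) :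
    (x - y) * prodQuotient x y =
      denomFun x * multiplierFun x - denomFun y * multiplierFun y := by
  rw [← sum_prodCoeff, ← sum_prodCoeff, ← Finset.sum_sub_distrib, Finset.sum_range_succ' _ 14,
    prodQuotient, Finset.mul_sum]
  simp only [pow_zero, sub_self, add_zero]
  refine Finset.sum_congr rfl fun k _ => ?_
  have h := (Commute.all x y).geom_sum₂_mul (k + 1)
  simp only [Nat.add_sub_cancel] at h
  rw [← mul_sub, ← h]
  ring

/-- On the polydisc of radius `1 / 4`, in any seminormed ring, the linear term of
`denomFun * multiplierFun` dominates the difference quotient. -/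
lemma le_prodQuotient_mul (ν : A → ℝ) (hadd : ∀ f g, ν (f + g) ≤ ν f + ν g)
    (hmul : ∀ f g, ν (f * g) ≤ ν f * ν g) (hint : ∀ (n : ℤ) f, ν (n * f) = |(n : ℝ)| * ν f)
    (h0 : ∀ f, 0 ≤ ν f) {x y : A} (hx : ν x ≤ 1 / 4) (hy : ν y ≤ 1 / 4) (B : A) :
    20 * ν B ≤ ν (prodQuotient x y * B) := by
  have hz : ν 0 = 0 := by simpa using hint 0 0
  have hneg : ∀ f, ν (-f) = ν f := fun f => by simpa using hint (-1) f
  have hpow : ∀ w, ν w ≤ 1 / 4 → ∀ i f, ν (w ^ i * f) ≤ (1 / 4) ^ i * ν f := by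
    intro w hw i
    induction i with
    | zero => simp
    | succ i ih =>
      intro f
      rw [pow_succ w, mul_assoc]
      refine (ih _).trans ?_
      rw [pow_succ, mul_assoc]
      gcongr
      exact (hmul _ _).trans (mul_le_mul_of_nonneg_right hw (h0 f))
  have hgeom : ∀ k, ν ((∑ i ∈ Finset.range (k + 1), x ^ i * y ^ (k - i)) * B) ≤
      (k + 1) * (1 / 4) ^ k * ν B := by
    intro k
    rw [Finset.sum_mul]
    refine (Finset.le_sum_of_subadditive ν hz.le hadd _ _).trans ?_
    have : ∀ i ∈ Finset.range (k + 1), ν (x ^ i * y ^ (k - i) * B) ≤ (1 / 4) ^ k * ν B := by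
      intro i hi
      have hi : i ≤ k := Nat.lt_succ_iff.1 (Finset.mem_range.1 hi)
      rw [mul_assoc]
      refine (hpow x hx i _).trans ?_
      calc (1 / 4 : ℝ) ^ i * ν (y ^ (k - i) * B) ≤ (1 / 4) ^ i * ((1 / 4) ^ (k - i) * ν B) := by
            gcongr
            exact hpow y hy _ _
        _ = (1 / 4) ^ k * ν B := by rw [← mul_assoc, ← pow_add, Nat.add_sub_cancel' hi]
    refine (Finset.sum_le_sum this).trans (le_of_eq ?_)
    simp
    ring
  -- The linear coefficient is `-84`; the others contribute at most `64`.
  have hsplit : ((-84 : ℤ) : A) * B = prodQuotient x y * B +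
      -∑ k ∈ Finset.range 13, (prodCoeff (k + 2) : A) *
        ((∑ i ∈ Finset.range (k + 2), x ^ i * y ^ (k + 1 - i)) * B) := by
    rw [prodQuotient, Finset.sum_range_succ', add_mul, Finset.sum_mul]
    simp [prodCoeff, mul_assoc]
  have hrest : ν (∑ k ∈ Finset.range 13, (prodCoeff (k + 2) : A) *
      ((∑ i ∈ Finset.range (k + 2), x ^ i * y ^ (k + 1 - i)) * B)) ≤ 64 * ν B := by
    refine (Finset.le_sum_of_subadditive ν hz.le hadd _ _).trans ?_
    have : ∀ k ∈ Finset.range 13, ν ((prodCoeff (k + 2) : A) *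
        ((∑ i ∈ Finset.range (k + 2), x ^ i * y ^ (k + 1 - i)) * B)) ≤
        |(prodCoeff (k + 2) : ℝ)| * (((k + 1 : ℕ) + 1) * (1 / 4) ^ (k + 1)) * ν B := by
      intro k _
      rw [hint, mul_assoc]
      gcongr
      exact hgeom (k + 1)
    refine (Finset.sum_le_sum this).trans ?_
    rw [← Finset.sum_mul]
    gcongr
    · exact h0 B
    · simp only [Finset.sum_range_succ, Finset.sum_range_zero, prodCoeff,
        List.getD_cons_zero, List.getD_cons_succ]
      norm_num [abs_of_pos, abs_of_neg]
  have h := hadd (prodQuotient x y * B) (-∑ k ∈ Finset.range 13, (prodCoeff (k + 2) : A) *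
        ((∑ i ∈ Finset.range (k + 2), x ^ i * y ^ (k + 1 - i)) * B))
  rw [← hsplit, hint, hneg] at h
  have h84 : |((-84 : ℤ) : ℝ)| = 84 := by norm_num
  rw [h84] at h
  linarith

end Multiplier

lemma aeval_denomP3 {A : Type*} [CommRing A] [Algebra ℤ A] (x : A) :
    Polynomial.aeval x denomP3 = denomFun x := by
  have h (n : ℕ) [n.AtLeastTwo] : Polynomial.aeval x (OfNat.ofNat n : Polynomial ℤ) =
      (OfNat.ofNat n : A) := map_ofNat (Polynomial.aeval x) n
  simp [denomP3, denomFun, h]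

lemma natDegree_denomP3 : denomP3.natDegree = 7 := by
  unfold denomP3
  compute_degree!

lemma exists_root_denomP3 : ∃ z : ℝ, 0.2397882 < z ∧ z < 0.2397884 ∧ denomFun z = 0 := by
  have hc : ContinuousOn (denomFun : ℝ → ℝ) (Set.Icc 0.2397882 0.2397884) := by
    unfold denomFun
    fun_prop
  obtain ⟨z, hz, h⟩ := intermediate_value_Ioo' (by norm_num) hc
    (show (0 : ℝ) ∈ Set.Ioo (denomFun 0.2397884) (denomFun 0.2397882) by
      constructor <;> norm_num [denomFun])
  exact ⟨z, hz.1, hz.2, h⟩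

lemma eq_of_denomFun_eq_zero {w v : ℂ} (hw : ‖w‖ ≤ 1 / 4) (hv : ‖v‖ ≤ 1 / 4)
    (hw0 : denomFun w = 0) (hv0 : denomFun v = 0) : w = v := by
  have h := sub_mul_prodQuotient w v
  rw [hw0, hv0] at h
  have hle := le_prodQuotient_mul (fun f : ℂ => ‖f‖) norm_add_le norm_mul_le
    (fun n f => by simp) norm_nonneg hw hv (w - v)
  rw [mul_comm _ (w - v), h] at hle
  simp only [zero_mul, sub_self, norm_zero] at hle
  have := norm_nonneg (w - v)
  exact sub_eq_zero.1 (norm_eq_zero.1 (by linarith))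

/-! ### The growth rate -/

/-- The Catalan series with real coefficients. -/
noncomputable def catalanSeriesReal : PowerSeries ℝ :=
  PowerSeries.catalanSeries.map (Nat.castRingHom ℝ)

lemma catalanSeriesReal_eq : catalanSeriesReal = 1 + PowerSeries.X * catalanSeriesReal ^ 2 := by
  have h := congrArg (PowerSeries.map (Nat.castRingHom ℝ))
    PowerSeries.catalanSeries_sq_mul_X_add_one
  simp only [map_add, map_mul, map_pow, map_one, PowerSeries.map_X] at h
  rw [catalanSeriesReal]
  linear_combination -h

/-- The partial sums stay below `2`, since `x ↦ 1 + z * x ^ 2` maps `[0, 2]` to itself. -/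
lemma truncNorm_catalanSeriesReal_le {z : ℝ} (h0 : 0 ≤ z) (h1 : z ≤ 1 / 4) (N : ℕ) :
    truncNorm z N catalanSeriesReal ≤ 2 := by
  induction N with
  | zero => simp [truncNorm]
  | succ N ih =>
    have hrec : truncNorm z (N + 1) catalanSeriesReal =
        z * truncNorm z N (catalanSeriesReal ^ 2) + 1 := by
      rw [truncNorm, Finset.sum_range_succ', truncNorm, Finset.mul_sum]
      congr 1
      · refine Finset.sum_congr rfl fun n _ => ?_
        nth_rewrite 1 [catalanSeriesReal_eq]
        rw [map_add, PowerSeries.coeff_succ_X_mul, PowerSeries.coeff_one,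
          if_neg (Nat.succ_ne_zero n), zero_add, pow_succ]
        ring
      · rw [catalanSeriesReal_eq]
        simp
    have hmul := truncNorm_mul_le h0 N catalanSeriesReal catalanSeriesReal
    have hnn := truncNorm_nonneg h0 N catalanSeriesReal
    have hnn' := truncNorm_nonneg h0 N (catalanSeriesReal ^ 2)
    rw [← sq] at hmul
    rw [hrec]
    nlinarith

/-- The square root series with real coefficients. -/
noncomputable def sqrtSeriesReal : PowerSeries ℝ := sqrtSeries.map (Int.castRingHom ℝ)

lemma sqrtSeriesReal_eq : sqrtSeriesReal = 1 - 2 * PowerSeries.X * catalanSeriesReal := by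
  have : PowerSeries.map (Int.castRingHom ℝ)
      (PowerSeries.map (Nat.castRingHom ℤ) PowerSeries.catalanSeries) = catalanSeriesReal := by
    ext n
    simp [catalanSeriesReal]
  simp only [sqrtSeriesReal, sqrtSeries, map_sub, map_mul, map_one, map_ofNat, PowerSeries.map_X,
    this]

/-- The square root series converges to a nonnegative number on `[0, 1 / 4]`. The sign matters: at
the dominant root the other square root of `1 - 4 z` makes the numerator vanish. -/
lemma exists_hasEval_sqrtSeriesReal {z : ℝ} (h0 : 0 ≤ z) (h1 : z ≤ 1 / 4) :
    ∃ σ, HasEval z sqrtSeriesReal σ ∧ 0 ≤ σ := by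
  obtain ⟨c, hc⟩ := exists_hasEval_of_truncNorm_le h0 (truncNorm_catalanSeriesReal_le h0 h1)
  have hc2 : c ≤ 2 := by
    refine le_of_tendsto' (HasSum.tendsto_sum_nat hc) fun N => ?_
    refine le_trans (Finset.sum_le_sum fun n _ => ?_) (truncNorm_catalanSeriesReal_le h0 h1 N)
    gcongr
    exact le_abs_self _
  refine ⟨1 - 2 * z * c, ?_, by nlinarith⟩
  rw [sqrtSeriesReal_eq]
  exact .sub .one (.mul (.mul (.ofNat 2) .X) hc)

/-- The numerator of the closed form with real coefficients. -/
noncomputable def numerReal : PowerSeries ℝ :=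
  PowerSeries.X * (1 - PowerSeries.X) * (1 - 2 * PowerSeries.X) *
    (1 - 7 * PowerSeries.X + 17 * PowerSeries.X ^ 2 - 16 * PowerSeries.X ^ 3
      + 4 * PowerSeries.X ^ 4 + (1 - 3 * PowerSeries.X + 3 * PowerSeries.X ^ 2) * sqrtSeriesReal)

lemma exists_hasEval_numerReal {z : ℝ} (h0 : 0.2397882 < z) (h1 : z < 0.2397884) :
    ∃ v, HasEval z numerReal v ∧ v ≠ 0 := by
  obtain ⟨σ, hσ, hσ0⟩ := exists_hasEval_sqrtSeriesReal (z := z) (by linarith) (by linarith)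
  refine ⟨_, .mul (.mul (.mul .X (.sub .one .X)) (.sub .one (.mul (.ofNat 2) .X)))
    (.add (.add (.sub (.add (.sub .one (.mul (.ofNat 7) .X)) (.mul (.ofNat 17) (.pow .X 2)))
      (.mul (.ofNat 16) (.pow .X 3))) (.mul (.ofNat 4) (.pow .X 4)))
      (.mul (.add (.sub .one (.mul (.ofNat 3) .X)) (.mul (.ofNat 3) (.pow .X 2))) hσ)), ?_⟩
  have z2l : 0.0574 ≤ z ^ 2 := by nlinarith
  have z3 : z ^ 3 ≤ 0.0138 := by nlinarith
  have z4 : 0 ≤ z ^ 4 := by positivity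
  have hs : 0 ≤ (1 - 3 * z + 3 * z ^ 2) * σ := mul_nonneg (by nlinarith) hσ0
  have hpos : 0 < 1 - 7 * z + 17 * z ^ 2 - 16 * z ^ 3 + 4 * z ^ 4 +
      (1 - 3 * z + 3 * z ^ 2) * σ := by
    linarith
  have f1 : 0 < 1 - z := by linarith
  have f2 : 0 < 1 - 2 * z := by linarith
  have f0 : 0 < z := by linarith
  positivity

/-- The real generating function without its constant term. -/
noncomputable def genFunReal : PowerSeries ℝ :=
  genFunP3.map (Int.castRingHom ℝ) - 1

lemma coeff_genFunReal {n : ℕ} (hn : n ≠ 0) : PowerSeries.coeff n genFunReal = avCount n := by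
  simp [genFunReal, genFunP3, PowerSeries.coeff_one, hn]

lemma denomFun_mul_genFunReal :
    denomFun (PowerSeries.X : PowerSeries ℝ) * genFunReal = numerReal := by
  have h := congrArg (PowerSeries.map (Int.castRingHom ℝ)) denomP3_mul_genFunP3_sub_one
  rw [coe_denomP3, numerP3] at h
  simp only [map_mul, map_sub, map_add, map_pow, map_one, map_ofNat, PowerSeries.map_X] at h
  exact h

lemma coeff_zero_genFunReal : PowerSeries.coeff 0 genFunReal = 0 := by
  have h := congrArg PowerSeries.constantCoeff denomFun_mul_genFunReal
  simpa [denomFun, numerReal, map_ofNat (PowerSeries.constantCoeff (R := ℝ))] using h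

/-- The singularity at the dominant root `z` is a simple pole: `aₙ zⁿ⁺¹` has a positive limit. -/
lemma exists_tendsto_avCount_mul_pow {z : ℝ} (h0 : 0.2397882 < z) (h1 : z < 0.2397884)
    (hz : denomFun z = 0) :
    ∃ c, 0 < c ∧ Tendsto (fun n : ℕ => (avCount n : ℝ) * z ^ (n + 1)) atTop (𝓝 c) := by
  have hz0 : 0 ≤ z := by linarith
  obtain ⟨v, hv, hv0⟩ := exists_hasEval_numerReal h0 h1
  set x : PowerSeries ℝ := PowerSeries.X
  set y : PowerSeries ℝ := PowerSeries.C z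
  have hx : HasEval z x z := .X
  have hy : HasEval z y z := .const z
  -- `B` is the generating function with its pole at `z` removed.
  set B : PowerSeries ℝ := (x - y) * genFunReal with hB
  have hyz : denomFun y = 0 := by
    have h := congrArg (PowerSeries.C (R := ℝ)) hz
    simp only [denomFun, map_add, map_sub, map_mul, map_pow, map_ofNat, map_zero] at h
    exact h
  have hKB : prodQuotient x y * B = multiplierFun x * numerReal := by
    rw [hB, ← mul_assoc, mul_comm (prodQuotient x y), sub_mul_prodQuotient, hyz,
      ← denomFun_mul_genFunReal]
    ring
  have hmult : HasEval z (multiplierFun x) (multiplierFun z) :=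
    .add (.add (.add (.add (.add (.add (.add (.ofNat 10) (.mul (.ofNat 68) hx))
      (.mul (.ofNat 271) (hx.pow 2))) (.mul (.ofNat 806) (hx.pow 3)))
      (.mul (.ofNat 1944) (hx.pow 4))) (.mul (.ofNat 3904) (hx.pow 5)))
      (.mul (.ofNat 6368) (hx.pow 6))) (.mul (.ofNat 7365) (hx.pow 7))
  have hprod := hmult.mul hv
  have hquot : ∃ κ, HasEval z (prodQuotient x y) κ := by
    have hsum : ∀ (n : ℕ) (f : ℕ → PowerSeries ℝ), (∀ k, ∃ κ, HasEval z (f k) κ) →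
        ∃ κ, HasEval z (∑ k ∈ Finset.range n, f k) κ := by
      intro n f hf
      induction n with
      | zero => exact ⟨0, by simpa using (HasEval.const (t := z) 0)⟩
      | succ n ih =>
        obtain ⟨a, ha⟩ := ih
        obtain ⟨b, hb⟩ := hf n
        exact ⟨_, by rw [Finset.sum_range_succ]; exact ha.add hb⟩
    refine hsum _ _ fun k => ?_
    obtain ⟨κ, hκ⟩ := hsum (k + 1) (fun i => x ^ i * y ^ (k - i)) fun i =>
      ⟨_, (hx.pow i).mul (hy.pow (k - i))⟩
    have hc := HasEval.const (t := z) (prodCoeff (k + 1) : ℝ)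
    rw [map_intCast] at hc
    exact ⟨_, hc.mul hκ⟩
  have hXt : ∀ N, truncNorm z N x ≤ 1 / 4 := by
    intro N
    refine (truncNorm_le_of_hasEval hz0 N hx).trans ?_
    rw [tsum_eq_single 1 (fun n hn => by simp [x, PowerSeries.coeff_X, hn])]
    simp [x, abs_of_nonneg hz0]
    linarith
  have hCt : ∀ N, truncNorm z N y ≤ 1 / 4 := by
    intro N
    refine (truncNorm_le_of_hasEval hz0 N hy).trans ?_
    rw [tsum_eq_single 0 (fun n hn => by simp [y, PowerSeries.coeff_C, hn])]
    simp [y, abs_of_nonneg hz0]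
    linarith
  have hbound : ∀ N, truncNorm z N B ≤
      (∑' n, |PowerSeries.coeff n (multiplierFun x * numerReal) * z ^ n|) / 20 := by
    intro N
    have h := le_prodQuotient_mul (truncNorm z N) (truncNorm_add_le hz0 N)
      (truncNorm_mul_le hz0 N)
      (fun n f => by rw [← truncNorm_C_mul N, map_intCast]) (truncNorm_nonneg hz0 N)
      (hXt N) (hCt N) B
    rw [hKB] at h
    have h' := truncNorm_le_of_hasEval hz0 N hprod
    linarith
  obtain ⟨β, hβ⟩ := exists_hasEval_of_truncNorm_le hz0 hbound
  obtain ⟨κ, hκ⟩ := hquot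
  have hβ0 : β ≠ 0 := by
    rintro rfl
    have h := hκ.mul hβ
    rw [hKB] at h
    have := HasSum.unique h hprod
    rw [mul_zero] at this
    have hpos : 0 < multiplierFun z := by
      unfold multiplierFun
      positivity
    exact mul_ne_zero hpos.ne' hv0 this.symm
  -- The partial sums of `B` at `z` telescope.
  have htel : ∀ N, ∑ n ∈ Finset.range (N + 1), PowerSeries.coeff n B * z ^ n =
      -(PowerSeries.coeff N genFunReal * z ^ (N + 1)) := by
    intro N
    induction N with
    | zero => simp [hB, x, y, sub_mul, coeff_zero_genFunReal]
    | succ N ih =>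
      rw [Finset.sum_range_succ, ih, hB, sub_mul, map_sub, PowerSeries.coeff_succ_X_mul,
        PowerSeries.coeff_C_mul]
      ring
  have hlim : Tendsto (fun n : ℕ => (avCount n : ℝ) * z ^ (n + 1)) atTop (𝓝 (-β)) := by
    have h := ((HasSum.tendsto_sum_nat hβ).comp (tendsto_add_atTop_nat 1)).neg
    refine h.congr' ?_
    filter_upwards [eventually_ne_atTop 0] with n hn
    simp only [Function.comp_apply]
    rw [htel, coeff_genFunReal hn, neg_neg]
  have hnonneg : 0 ≤ -β := ge_of_tendsto' hlim fun n => by positivity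
  exact ⟨-β, lt_of_le_of_ne hnonneg (neg_ne_zero.2 hβ0).symm, hlim⟩

lemma hasGrowthRate_of_tendsto {u : ℕ → ℕ} {z c : ℝ} (hz : 0 < z) (hc : 0 < c)
    (h : Tendsto (fun n : ℕ => (u n : ℝ) * z ^ (n + 1)) atTop (𝓝 c)) :
    HasGrowthRate u (1 / z) := by
  have hinv : Tendsto (fun n : ℕ => 1 / (n : ℝ)) atTop (𝓝 0) := tendsto_one_div_atTop_nhds_zero_nat
  have h1 := h.rpow hinv (.inl hc.ne')
  have h2 : Tendsto (fun n : ℕ => z ^ (-(1 + 1 / (n : ℝ)))) atTop (𝓝 (z ^ (-(1 + 0) : ℝ))) :=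
    tendsto_const_nhds.rpow (hinv.const_add 1).neg (.inl hz.ne')
  have h3 := h1.mul h2
  rw [Real.rpow_zero, one_mul, add_zero, Real.rpow_neg_one, ← one_div] at h3
  refine h3.congr' ?_
  filter_upwards [eventually_ne_atTop 0] with n hn
  have hn' : (n : ℝ) ≠ 0 := Nat.cast_ne_zero.2 hn
  rw [Real.mul_rpow (by positivity) (by positivity), ← Real.rpow_natCast z, ← Real.rpow_mul hz.le,
    mul_assoc, ← Real.rpow_add hz]
  have : ((n + 1 : ℕ) : ℝ) * (1 / (n : ℝ)) + -(1 + 1 / (n : ℝ)) = 0 := by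
    push_cast
    field_simp
    ring
  rw [this, Real.rpow_zero, mul_one]

theorem corollarys :
    (∃ s : PowerSeries ℤ, PowerSeries.constantCoeff s = 1 ∧ s ^ 2 = 1 - 4 * PowerSeries.X ∧
      (denomP3 : PowerSeries ℤ) * (genFunP3 - 1) = numerP3 s) ∧
    denomP3.natDegree = 7 ∧
    ∃ z : ℝ,
      Polynomial.aeval z denomP3 = 0 ∧
      |z - 0.239788| < 5 * 10 ^ (-7 : ℤ) ∧
      0 < z ∧ z < 1 / 4 ∧
      (∀ w : ℂ, ‖w‖ ≤ 1 / 4 → Polynomial.aeval w denomP3 = 0 → w = (z : ℂ)) ∧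
      HasGrowthRate avCount (1 / z) ∧
      |1 / z - 4.17035| < 10 ^ (-5 : ℤ) := by
  refine ⟨⟨sqrtSeries, constantCoeff_sqrtSeries, sqrtSeries_sq, denomP3_mul_genFunP3_sub_one⟩,
    natDegree_denomP3, ?_⟩
  obtain ⟨z, h0, h1, hz⟩ := exists_root_denomP3
  have hpos : 0 < z := by linarith
  refine ⟨z, by rw [aeval_denomP3, hz], ?_, hpos, by linarith, fun w hw hw0 => ?_, ?_, ?_⟩
  · rw [abs_lt]
    norm_num
    constructor <;> linarith
  · rw [aeval_denomP3] at hw0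
    refine eq_of_denomFun_eq_zero hw ?_ hw0 ?_
    · rw [Complex.norm_real, Real.norm_of_nonneg hpos.le]
      linarith
    · have h := congrArg (fun r : ℝ => (r : ℂ)) hz
      simpa [denomFun] using h
  · obtain ⟨c, hc, hlim⟩ := exists_tendsto_avCount_mul_pow h0 h1 hz
    exact hasGrowthRate_of_tendsto hpos hc hlim
  · rw [abs_lt, lt_sub_iff_add_lt, sub_lt_iff_lt_add, lt_div_iff₀ hpos, div_lt_iff₀ hpos]
    norm_num
    constructor <;> linarith
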